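/- Let $K_q$ be a local field of characteristic $p>0$ (complete, locally compact, non-discrete, non-Archimedean) whose residue field has $q=p^c$ elements, $c\ge 1$. Let $\mathcal D_q=\{|x|\le 1\}$, let $\mathfrak p$ be a prime element, $|\mathfrak p|=q^{-1}$, and let $dx$ be the Haar measure with $|\mathcal D_q|=1$. Let $1=e_0,e_1,\dots,e_{c-1}$ be elements of the subfield $GF(q)\subset K_q$ (so $e_i^q=e_i$) whose residue classes form a basis of the residue field over $GF(p)$, and let $\chi$ be the additive character of $K_q$ that is trivial on $\mathcal D_q$ with $\chi(e_i\mathfrak p^{-j})=e^{2\pi i/p}$ if $i=0$, $j=1$ and $\chi(e_i\mathfrak p^{-j})=1$ for all other $0\le i<c$, $j\in\mathbb Z$. For $0\le n<q$, $n=\sum_{i<c}u_ip^i$ with $0\le u_i<p$, put $\lambda(n)=\bigl(\sum_{i<c} u_ie_i\bigr)\mathfrak p^{-1}$; for $n=\sum_s v_sq^s$ with $0\le v_s<q$ put $\lambda(n)=\sum_s\mathfrak p^{-s}\lambda(v_s)$; and let $\chi_k(x)=\chi(\lambda(k)x)$. The Fourier transform is $\hat\theta(\xi)=\int\theta(x)\chi(-\xi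 x)\,dx$ for locally constant compactly supported $\theta$, and is extended to tempered distributions by duality. For $\mathfrak s\in\mathbb R$, $H^{\mathfrak s}(K_q)$ is the space of tempered distributions $f$ whose Fourier transform is a locally integrable function with $\int(1+|\xi|^2)^{\mathfrak s}|\hat f(\xi)|^2d\xi<\infty$, with inner product $\langle f,g\rangle=\int(1+|\xi|^2)^{\mathfrak s}\hat f(\xi)\overline{\hat g(\xi)}\,d\xi$. For a tempered distribution $f$, $\nu\in\mathbb Z$ and $k\in\mathbb N_0$ write $f_{\nu,k}=q^{\nu/2}f(\mathfrak p^{-\nu}\cdot-\lambda(k))$; in particular $f_{0,k}=f(\cdot-\lambda(k))$. Let $\nu,j\in\mathbb Z$ (the base level is $\nu=0$) and let $\varphi^{(j+1)}$ be such that $\{\varphi^{(j+1)}_{\nu+1,k}:k\in\mathbb N_0\}$ is an orthonormal system in $H^{\mathfrak s}(K_q)$; for $\nu=0$ this is the system $\{q^{1/2}\varphi^{(j+1)}(\mathfrak p^{-1}\cdot-\lambda(k)):k\in\mathbb N_0\}$. Let $\mathsf V$ be the closed linear span of this system in $H^{\mathfrak s}(K_q)$. For $0\le l\le q-1$ let $\{\alpha^{(j+1)}_{k,l}\}_{k}\in\ell^2(\mathbb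 N_0)$. Then for each $l$ the series $m^{(j+1)}_l(\xi)=q^{-1/2}\sum_{k=0}^\infty\alpha^{(j+1)}_{k,l}\overline{\chi_k(\xi)}$ converges in $L^2$ on every ball, and $\hat\psi^{(j)}_l(\xi)=m^{(j+1)}_l(\mathfrak p\xi)\,\hat\varphi^{(j+1)}(\mathfrak p\xi)$ is the Fourier transform of a tempered distribution $\psi^{(j)}_l$ such that $(\psi^{(j)}_l)_{\nu,k}\in\mathsf V$ for all $k\in\mathbb N_0$. Moreover, the system $\{(\psi^{(j)}_l)_{\nu,k}:0\le l\le q-1,\ k\in\mathbb N_0\}$ (for $\nu=0$: $\{\psi^{(j)}_l(\cdot-\lambda(k))\}$) in $\mathsf V$ is orthonormal in $H^{\mathfrak s}(K_q)$ if and only if the matrix $$M^{(j+1)}(\xi)=\Bigl(m^{(j+1)}_l(\mathfrak p\xi+\mathfrak p\lambda(k))\Bigr)_{l,k=0}^{q-1}$$ is unitary for a.e. $\xi\in\mathcal D_q$. -/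

import Mathlib

open MeasureTheory Filter Topology

/-- Standing data on a local field `K` of characteristic `p` whose residue field has `q = p ^ c`
elements: a prime element `ϖ` (normalised by `‖ϖ‖ = 1 / q`), elements `1 = e 0, …, e (c - 1)` of the
copy of `GF(q)` inside `K` (the solutions of `x ^ q = x`) which form a basis over `GF(p)`, and
the basic additive character `χ` of `K` belonging to these choices. -/
structure LocalFieldData (p c : ℕ) [NeZero c] (K : Type*) [NontriviallyNormedField K] where
  /-- The prime element, as a unit of the field. -/
  ϖ : Kˣ
  norm_ϖ : ‖(ϖ : K)‖ = ((p ^ c : ℕ) : ℝ)⁻¹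
  /-- `ϖ` has the largest absolute value in the prime ideal. -/
  norm_le_of_lt_one : ∀ x : K, ‖x‖ < 1 → ‖x‖ ≤ ‖(ϖ : K)‖
  e : Fin c → K
  e_zero : e 0 = 1
  norm_e : ∀ i, ‖e i‖ = 1
  e_pow : ∀ i, e i ^ (p ^ c) = e i
  /-- The classes of the `e i` modulo the prime ideal are a `GF(p)`-basis of the residue field. -/
  existsUnique_residue : ∀ x : K, ‖x‖ ≤ 1 →
    ∃! u : Fin c → Fin p, ‖x - ∑ i, ((u i : ℕ) : K) * e i‖ < 1
  χ : AddChar K Circle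
  /-- `χ` is trivial on the ring of integers. -/
  χ_eq_one : ∀ x : K, ‖x‖ ≤ 1 → χ x = 1
  χ_apply : ∀ (i : Fin c) (j : ℤ), (χ (e i * (ϖ : K) ^ (-j)) : ℂ) =
    if i = 0 ∧ j = 1 then Complex.exp (2 * Real.pi * Complex.I / p) else 1

namespace LocalFieldData

section Translations

variable {p c : ℕ} [NeZero c] {K : Type*} [NontriviallyNormedField K]

/-- `λ(n)`: if `n = ∑ s, v s * q ^ s` with `0 ≤ v s < q`, and `v s = ∑ i, u s i * p ^ i` with
`0 ≤ u s i < p`, then `λ(n) = ∑ s, ϖ ^ (-s) * ((∑ i, u s i * e i) * ϖ ^ (-1))`. -/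
def lam (D : LocalFieldData p c K) (n : ℕ) : K :=
  ∑ s ∈ Finset.range (n + 1),
    (D.ϖ : K) ^ (-(s : ℤ)) *
      ((∑ i : Fin c, ((n / (p ^ c) ^ s % p ^ c / p ^ (i : ℕ) % p : ℕ) : K) * D.e i) *
        (D.ϖ : K) ^ (-1 : ℤ))

end Translations

end LocalFieldData

/-- The space `S(K)` of test functions on `K`: locally constant functions with compact support. -/
def SchwartzBruhat (K : Type*) [NontriviallyNormedField K] : Submodule ℂ (K → ℂ) where
  carrier := {f | IsLocallyConstant f ∧ HasCompactSupport f}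
  add_mem' hf hg := ⟨hf.1.add hg.1, hf.2.add hg.2⟩
  zero_mem' := ⟨IsLocallyConstant.const 0, HasCompactSupport.zero⟩
  smul_mem' a _ hf := ⟨hf.1.comp (fun z => a • z), hf.2.smul_left (f := fun _ => a)⟩

/-- Tempered distributions on `K`. In the usual topology of the space of test functions of a local
field, the inductive limit of its finite-dimensional subspaces, every linear functional
is continuous, so the dual is the full algebraic dual. -/
abbrev TemperedDistr (K : Type*) [NontriviallyNormedField K] := SchwartzBruhat K →ₗ[ℂ] ℂ

section Affine

variable {K : Type*} [NontriviallyNormedField K]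

/-- The operation `θ ↦ θ(a⁻¹(· + b))` on test functions. -/
def SchwartzBruhat.affine (a : Kˣ) (b : K) : SchwartzBruhat K →ₗ[ℂ] SchwartzBruhat K where
  toFun θ := ⟨fun x => (θ : K → ℂ) ((a⁻¹ : Kˣ) * (x + b)), by
    have hh : ∀ x, ((Homeomorph.addRight b).trans (Homeomorph.mulLeft₀ ((a⁻¹ : Kˣ) : K)
        (Units.ne_zero _))) x = (a⁻¹ : Kˣ) * (x + b) := fun x => rfl
    refine ⟨?_, ?_⟩
    · exact θ.2.1.comp_continuous (by fun_prop)
    · exact θ.2.2.comp_homeomorph ((Homeomorph.addRight b).trans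
        (Homeomorph.mulLeft₀ ((a⁻¹ : Kˣ) : K) (Units.ne_zero _)))⟩
  map_add' _ _ := rfl
  map_smul' _ _ := rfl

/-- The distribution `f(a · - b)`, that is `θ ↦ |a|⁻¹ ⟨f, θ(a⁻¹(· + b))⟩`. -/
noncomputable def TemperedDistr.affine (f : TemperedDistr K) (a : Kˣ) (b : K) : TemperedDistr K :=
  ((‖(a : K)‖⁻¹ : ℝ) : ℂ) • f.comp (SchwartzBruhat.affine a b)

end Affine

section Haar

variable (K : Type*) [NontriviallyNormedField K] [LocallyCompactSpace K]

/-- The ring of integers of `K` as a compact set with non-empty interior. -/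
def ringOfIntegersCompacts : TopologicalSpace.PositiveCompacts K where
  carrier := Metric.closedBall 0 1
  isCompact' := by
    have : ProperSpace K := ProperSpace.of_locallyCompactSpace K
    exact isCompact_closedBall 0 1
  interior_nonempty' :=
    ⟨0, interior_mono Metric.ball_subset_closedBall
      (by rw [Metric.isOpen_ball.interior_eq]; exact Metric.mem_ball_self one_pos)⟩

/-- The Haar measure of `K` which gives the ring of integers measure `1`. -/
noncomputable def haarK [MeasurableSpace K] [BorelSpace K] : Measure K :=
  Measure.addHaarMeasure (ringOfIntegersCompacts K)

instance [MeasurableSpace K] [BorelSpace K] : (haarK K).IsAddHaarMeasure := by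
  unfold haarK; infer_instance

end Haar

namespace LocalFieldData

section Helpers

variable {p c : ℕ} [NeZero c] {K : Type*} [NontriviallyNormedField K]

theorem χ_add_eq (D : LocalFieldData p c K) (x h : K) (hh : ‖h‖ ≤ 1) : D.χ (x + h) = D.χ x := by
  rw [AddChar.map_add_eq_mul, D.χ_eq_one h hh, mul_one]

theorem isLocallyConstant_χ (D : LocalFieldData p c K) : IsLocallyConstant D.χ := by
  rw [IsLocallyConstant.iff_eventually_eq]
  intro x
  filter_upwards [Metric.closedBall_mem_nhds x one_pos] with y hy
  have := D.χ_add_eq x (y - x) (by simpa [dist_eq_norm] using hy)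
  simpa using this

theorem χ_inv_ϖ_ne_one [Fact p.Prime] (D : LocalFieldData p c K) :
    D.χ ((D.ϖ : K)⁻¹) ≠ 1 := by
  intro h
  have h1 := D.χ_apply 0 1
  simp only [D.e_zero, one_mul, zpow_neg, zpow_one, and_self, if_true] at h1
  rw [h] at h1
  have hp : p ≠ 0 := (Fact.out : p.Prime).ne_zero
  have h2 := Complex.isPrimitiveRoot_exp p hp
  exact h2.ne_one (Fact.out : p.Prime).one_lt h1.symm

/-- A test function is invariant under all small translations. -/
theorem exists_translation_invariant (f : SchwartzBruhat K) :
    ∃ δ > 0, ∀ x h : K, ‖h‖ < δ → (f : K → ℂ) (x + h) = (f : K → ℂ) x := by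
  obtain ⟨δ, hδ, H⟩ := lebesgue_number_lemma_of_metric (s := tsupport (f : K → ℂ)) f.2.2
    (c := fun z : ℂ => (f : K → ℂ) ⁻¹' {z}) (fun z => f.2.1 {z})
    (fun x _ => Set.mem_iUnion.2 ⟨(f : K → ℂ) x, rfl⟩)
  have key : ∀ x ∈ tsupport (f : K → ℂ), ∀ y, dist y x < δ →
      (f : K → ℂ) y = (f : K → ℂ) x := by
    intro x hx y hy
    obtain ⟨z, hz⟩ := H x hx
    have h1 : (f : K → ℂ) y = z := hz (Metric.mem_ball.2 hy)
    have h2 : (f : K → ℂ) x = z := hz (Metric.mem_ball_self hδ)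
    rw [h1, h2]
  refine ⟨δ, hδ, fun x h hh => ?_⟩
  by_cases hx : x ∈ tsupport (f : K → ℂ)
  · exact key x hx _ (by simpa [dist_eq_norm] using hh)
  by_cases hy : x + h ∈ tsupport (f : K → ℂ)
  · exact (key _ hy x (by simpa [dist_eq_norm] using hh)).symm
  · rw [image_eq_zero_of_notMem_tsupport hx, image_eq_zero_of_notMem_tsupport hy]

end Helpers

section Fourier

variable {p c : ℕ} [NeZero c] {K : Type*} [NontriviallyNormedField K]
  [LocallyCompactSpace K] [MeasurableSpace K] [BorelSpace K]

theorem integrable_schwartzBruhat (f : SchwartzBruhat K) :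
    Integrable (f : K → ℂ) (haarK K) :=
  f.2.1.continuous.integrable_of_hasCompactSupport f.2.2

theorem fourierIntegral_mem [Fact p.Prime] (D : LocalFieldData p c K) (f : SchwartzBruhat K) :
    Fourier.fourierIntegral D.χ (haarK K) (f : K → ℂ) ∈ SchwartzBruhat K := by
  have : ProperSpace K := ProperSpace.of_locallyCompactSpace K
  refine ⟨?_, ?_⟩
  · obtain ⟨R, hR⟩ := f.2.2.isBounded.subset_closedBall (0 : K)
    rw [IsLocallyConstant.iff_eventually_eq]
    intro w
    have hpos : (0 : ℝ) < (|R| + 1)⁻¹ := by positivity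
    filter_upwards [Metric.closedBall_mem_nhds w hpos] with y hy
    rw [Fourier.fourierIntegral_def, Fourier.fourierIntegral_def]
    congr 1
    funext v
    by_cases hv : v ∈ tsupport (f : K → ℂ)
    · have hv' : ‖v‖ ≤ R := by simpa [dist_eq_norm] using hR hv
      have hy' : ‖w - y‖ ≤ (|R| + 1)⁻¹ := by
        rw [Metric.mem_closedBall, dist_eq_norm, norm_sub_rev] at hy; exact hy
      have hle : ‖v * (w - y)‖ ≤ 1 := by
        rw [norm_mul]
        calc ‖v‖ * ‖w - y‖ ≤ (|R| + 1) * (|R| + 1)⁻¹ := by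
              apply mul_le_mul _ hy' (norm_nonneg _) (by positivity)
              linarith [le_abs_self R]
          _ = 1 := mul_inv_cancel₀ (by positivity)
      have := D.χ_add_eq (-(v * w)) (v * (w - y)) hle
      rw [← this]
      congr 2
      ring
    · rw [image_eq_zero_of_notMem_tsupport hv, smul_zero, smul_zero]
  · obtain ⟨δ, hδ, H⟩ := exists_translation_invariant f
    refine HasCompactSupport.of_support_subset_isCompact
      (isCompact_closedBall (0 : K) (‖(D.ϖ : K)⁻¹‖ / δ)) ?_
    intro w hw
    by_contra hlt
    rw [mem_closedBall_zero_iff, not_le, div_lt_iff₀ hδ] at hlt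
    have hw0 : w ≠ 0 := by
      rintro rfl
      rw [norm_zero, zero_mul] at hlt
      exact absurd hlt (not_lt.2 (norm_nonneg _))
    set h : K := (D.ϖ : K)⁻¹ * w⁻¹ with hh
    have hhδ : ‖h‖ < δ := by
      rw [hh, norm_mul, norm_inv w, ← div_eq_mul_inv, div_lt_iff₀ (norm_pos_iff.2 hw0)]
      linarith
    have e1 : (f : K → ℂ) ∘ (fun v => v + h) = (f : K → ℂ) := by
      funext v
      exact H v h hhδ
    have e2 := congrFun (Fourier.fourierIntegral_comp_add_right D.χ (haarK K) (f : K → ℂ) h) w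
    rw [e1] at e2
    have hhw : h * w = (D.ϖ : K)⁻¹ := by
      rw [hh, mul_assoc, inv_mul_cancel₀ hw0, mul_one]
    simp only [hhw, Circle.smul_def, smul_eq_mul] at e2
    have hne : Fourier.fourierIntegral D.χ (haarK K) (f : K → ℂ) w ≠ 0 := hw
    have e3 : (D.χ (D.ϖ : K)⁻¹ : ℂ) = 1 := by
      have := mul_right_cancel₀ hne (e2.symm.trans (one_mul _).symm)
      exact this
    exact D.χ_inv_ϖ_ne_one (Circle.ext (by simpa using e3))

variable [Fact p.Prime] (D : LocalFieldData p c K)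

/-- The Fourier transform `θ̂(ξ) = ∫ θ(x) χ(-ξ x) dx` on test functions. -/
noncomputable def fourierTest : SchwartzBruhat K →ₗ[ℂ] SchwartzBruhat K where
  toFun θ := ⟨Fourier.fourierIntegral D.χ (haarK K) (θ : K → ℂ), D.fourierIntegral_mem θ⟩
  map_add' θ η := Subtype.ext <| VectorFourier.fourierIntegral_add D.isLocallyConstant_χ.continuous
    (by simpa using continuous_mul) (integrable_schwartzBruhat θ) (integrable_schwartzBruhat η)
  map_smul' a θ := Subtype.ext <| Fourier.fourierIntegral_const_smul D.χ (haarK K) (θ : K → ℂ) a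

/-- The Fourier transform of the tempered distribution `f`, given by `⟨f̂, θ⟩ = ⟨f, θ̂⟩`, is
the locally integrable function `g`. -/
def HasFourier (f : TemperedDistr K) (g : K → ℂ) : Prop :=
  LocallyIntegrable g (haarK K) ∧
    ∀ θ : SchwartzBruhat K, f (D.fourierTest θ) = ∫ ξ, g ξ * (θ : K → ℂ) ξ ∂(haarK K)

open Classical in
/-- The function `f̂` (unique up to null sets) when the Fourier transform of `f` is a locally
integrable function. -/
noncomputable def hat (f : TemperedDistr K) : K → ℂ :=
  if h : ∃ g, D.HasFourier f g then h.choose else 0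

open Classical in
/-- The tempered distribution whose Fourier transform is the locally integrable function `g`. -/
noncomputable def invHat (g : K → ℂ) : TemperedDistr K :=
  if h : ∃ f, D.HasFourier f g then h.choose else 0

/-- `f ∈ H^s(K)`. -/
def MemSobolev (s : ℝ) (f : TemperedDistr K) : Prop :=
  ∃ g, D.HasFourier f g ∧ Integrable (fun ξ => (1 + ‖ξ‖ ^ 2) ^ s * ‖g ξ‖ ^ 2) (haarK K)

/-- The inner product of `H^s(K)`. -/
noncomputable def sobolevInner (s : ℝ) (f g : TemperedDistr K) : ℂ :=
  ∫ ξ, (((1 + ‖ξ‖ ^ 2) ^ s : ℝ) : ℂ) * (D.hat f ξ * star (D.hat g ξ)) ∂(haarK K)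

/-- The norm of `H^s(K)`. -/
noncomputable def sobolevNorm (s : ℝ) (f : TemperedDistr K) : ℝ :=
  √(∫ ξ, (1 + ‖ξ‖ ^ 2) ^ s * ‖D.hat f ξ‖ ^ 2 ∂(haarK K))

/-- `(u i)` is an orthonormal system in `H^s(K)`. -/
def OrthonormalSystem {ι : Type*} [DecidableEq ι] (s : ℝ) (u : ι → TemperedDistr K) : Prop :=
  (∀ i, D.MemSobolev s (u i)) ∧ ∀ i i', D.sobolevInner s (u i) (u i') = if i = i' then 1 else 0

/-- The closed linear span in `H^s(K)` of a family of elements of `H^s(K)`. -/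
def closedSpan {ι : Type*} (s : ℝ) (u : ι → TemperedDistr K) : Set (TemperedDistr K) :=
  {f | D.MemSobolev s f ∧
    ∀ ε > 0, ∃ g ∈ Submodule.span ℂ (Set.range u), D.sobolevNorm s (f - g) < ε}

/-- The distribution `q ^ (ν / 2) f(ϖ ^ (-ν) · - λ(k))`. -/
noncomputable def dilTrans (ν : ℤ) (f : TemperedDistr K) (k : ℕ) : TemperedDistr K :=
  ((((p ^ c : ℕ) : ℝ) ^ ((ν : ℝ) / 2) : ℝ) : ℂ) • f.affine (D.ϖ ^ (-ν)) (D.lam k)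

/-- `m(ξ) = q ^ (-1/2) ∑ k, a k * conj χ(λ(k) ξ)`, with convergence in `L²` on every ball. -/
def HasFilter (a : ℕ → ℂ) (m : K → ℂ) : Prop :=
  AEStronglyMeasurable m (haarK K) ∧
    ∀ R : ℝ, Tendsto (fun N : ℕ => eLpNorm
      (fun ξ => m ξ - ((((p ^ c : ℕ) : ℝ) ^ (-(1 / 2) : ℝ) : ℝ) : ℂ) *
        ∑ k ∈ Finset.range N, a k * star (D.χ (D.lam k * ξ) : ℂ))
      2 ((haarK K).restrict (Metric.closedBall 0 R))) atTop (𝓝 0)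

open Classical in
/-- The filter `m` with coefficient sequence `a` (unique up to null sets; it exists when `a` is
square summable). -/
noncomputable def filter (a : ℕ → ℂ) : K → ℂ :=
  if h : ∃ m, D.HasFilter a m then h.choose else 0

/-- The distribution `ψ` with `ψ̂(ξ) = m(ϖ ξ) f̂(ϖ ξ)`, `m` the filter with coefficients `a`. -/
noncomputable def wavelet (a : ℕ → ℂ) (f : TemperedDistr K) : TemperedDistr K :=
  D.invHat fun ξ => D.filter a (D.ϖ * ξ) * D.hat f (D.ϖ * ξ)

/-- The `q × q` matrix `(m_l(ϖ ξ + ϖ λ(k)))`, `m_l` the filter with coefficients `a l`. -/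
noncomputable def filterMatrix (a : Fin (p ^ c) → ℕ → ℂ) (ξ : K) :
    Matrix (Fin (p ^ c)) (Fin (p ^ c)) ℂ :=
  Matrix.of fun l k => D.filter (a l) (D.ϖ * ξ + D.ϖ * D.lam k)

end Fourier

end LocalFieldData

/-! Write `𝒟` for the ring of integers and `Λ = {λ(n)}`. In characteristic `p` digits add without
carry, so `Λ` is a group; it is a complement of `𝒟` in `K`, and `χ(xy) = 1` for `x, y ∈ Λ`
(`χ_lam_mul_lam`). Hence the characters `χ_k` are `Λ`-periodic, they restrict to an orthonormal
system on `𝒟`, and every character of the form `χ(ξ ·)` agrees on `𝒟` with some `χ_k`. The map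
`fold` sends `x` to its representative in `𝒟` modulo `Λ`.

Put `n = ν + 1` and `Φ = φ̂`. A distribution with transform `q^(-n/2) G(ϖ^n ξ) Φ(ϖ^n ξ)`, `G`
periodic, is said to have symbol `G`. After substituting `η = ϖ^n ξ`, its `H^s` norm is the `L²`
norm of `G` for the measure with density `(1 + |ϖ^(-n) η|²)^s |Φ(η)|²`. The `k`-th element of the
given system has symbol `conj χ_k`, so orthonormality prescribes the Fourier coefficients of the
folded measure; by uniqueness of Fourier transforms it is Haar measure on `𝒟`
(`map_fold_spectralMeasure`). Passing from symbols to distributions therefore preserves inner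
products between `L²(𝒟)` and `H^s`. Riesz–Fischer on `𝒟` gives the filters, and partial sums of
their series give membership in the closed span.

Since `ϖ⁻¹ λ(k) = λ(qk)`, the level-`ν` translates of `ψ_l` have symbols `q^(1/2) conj χ_{qk} m_l`.
Splitting `𝒟` into the `q` pieces `ϖλ(r) + ϖ𝒟` turns their inner products into the Fourier
coefficients on `𝒟` of the entries of `M M*` (`integral_waveletSymbol_mul_star`). These coefficients
are those of the constant identity matrix exactly when `M M* = 1` almost everywhere, which for a
square matrix is unitarity. -/

set_option linter.unusedSectionVars false

open scoped ENNReal NNReal BoundedContinuousFunction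

namespace LocalFieldData

/-! ### The lattice of the `λ(n)`: a complement of the ring of integers on which `χ(xy) = 1`. -/

section Lattice

variable {p c : ℕ} [NeZero c] {K : Type*} [NontriviallyNormedField K]

/-- The representative `∑ i, u i * e i` of the residue class with number `n = ∑ i, u i * p ^ i`. -/
def digit (D : LocalFieldData p c K) (n : ℕ) : K :=
  ∑ i : Fin c, ((n / p ^ (i : ℕ) % p : ℕ) : K) * D.e i

theorem ϖ_ne_zero (D : LocalFieldData p c K) : (D.ϖ : K) ≠ 0 := D.ϖ.ne_zero

theorem digit_zero (D : LocalFieldData p c K) : D.digit 0 = 0 := by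
  simp [digit]

theorem lam_zero (D : LocalFieldData p c K) : D.lam 0 = 0 := by
  simp [lam]

variable [Fact p.Prime]

theorem one_lt_card (p c : ℕ) [Fact p.Prime] [NeZero c] : 1 < p ^ c :=
  Nat.one_lt_pow (NeZero.ne c) (Fact.out : p.Prime).one_lt

theorem lam_eq_sum (D : LocalFieldData p c K) {n N : ℕ} (h : n < N) :
    D.lam n = ∑ s ∈ Finset.range N,
      (D.ϖ : K) ^ (-(s : ℤ)) * (D.digit (n / (p ^ c) ^ s % p ^ c) * (D.ϖ : K) ^ (-1 : ℤ)) := by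
  unfold lam
  refine Finset.sum_subset (Finset.range_mono h) fun s _ hs => ?_
  have hs' : n < s := by simpa using hs
  have : n / (p ^ c) ^ s = 0 :=
    Nat.div_eq_of_lt (hs'.trans (Nat.lt_pow_self (one_lt_card p c)))
  simp [this]

/-- Splitting off the lowest base-`q` digit; the later inductions on `n` use this recursion in place
of the digit sum. -/
theorem lam_rec (D : LocalFieldData p c K) (n : ℕ) :
    D.lam n = (D.ϖ : K)⁻¹ * (D.digit (n % p ^ c) + D.lam (n / p ^ c)) := by
  rw [D.lam_eq_sum (n.lt_succ_self.trans (n + 1).lt_succ_self),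
    D.lam_eq_sum (lt_of_le_of_lt (Nat.div_le_self n (p ^ c)) n.lt_succ_self),
    Finset.sum_range_succ', add_comm, mul_add, Finset.mul_sum]
  congr 1
  · simp [mul_comm]
  · refine Finset.sum_congr rfl fun s _ => ?_
    rw [Nat.div_div_eq_div_mul, ← pow_succ', Nat.cast_succ, neg_add, zpow_add₀ D.ϖ_ne_zero]
    simp only [zpow_neg, zpow_one]
    ring

theorem lam_of_lt (D : LocalFieldData p c K) {n : ℕ} (h : n < p ^ c) :
    D.lam n = (D.ϖ : K)⁻¹ * D.digit n := by
  rw [lam_rec, Nat.mod_eq_of_lt h, Nat.div_eq_of_lt h, lam_zero, add_zero]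

theorem inv_ϖ_mul_lam (D : LocalFieldData p c K) (n : ℕ) :
    (D.ϖ : K)⁻¹ * D.lam n = D.lam (p ^ c * n) := by
  rw [D.lam_rec (p ^ c * n), Nat.mul_mod_right, digit_zero, zero_add,
    Nat.mul_div_cancel_left _ (zero_lt_one.trans (one_lt_card p c))]

theorem lam_add_mul (D : LocalFieldData p c K) {v : ℕ} (hv : v < p ^ c) (k : ℕ) :
    D.lam (v + p ^ c * k) = (D.ϖ : K)⁻¹ * (D.digit v + D.lam k) := by
  rw [D.lam_rec (v + p ^ c * k), Nat.add_mul_mod_self_left, Nat.mod_eq_of_lt hv,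
    Nat.add_mul_div_left _ _ (zero_lt_one.trans (one_lt_card p c)), Nat.div_eq_of_lt hv, zero_add]

theorem digit_finFunctionFinEquiv (D : LocalFieldData p c K) (u : Fin c → Fin p) :
    D.digit (finFunctionFinEquiv u) = ∑ i, ((u i : ℕ) : K) * D.e i := by
  unfold digit
  refine Finset.sum_congr rfl fun i _ => ?_
  have := congrArg Fin.val (congrFun (finFunctionFinEquiv.symm_apply_apply u) i)
  rw [finFunctionFinEquiv_symm_apply_val] at this
  rw [this]

theorem exists_digit_sub_lt (D : LocalFieldData p c K) {x : K} (hx : ‖x‖ ≤ 1) :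
    ∃ v < p ^ c, ‖x - D.digit v‖ < 1 := by
  obtain ⟨u, hu, -⟩ := D.existsUnique_residue x hx
  exact ⟨finFunctionFinEquiv u, Fin.is_lt _, by rw [digit_finFunctionFinEquiv]; exact hu⟩

theorem norm_ϖ_pos (D : LocalFieldData p c K) : 0 < ‖(D.ϖ : K)‖ := norm_pos_iff.2 D.ϖ_ne_zero

theorem norm_ϖ_lt_one (D : LocalFieldData p c K) : ‖(D.ϖ : K)‖ < 1 := by
  rw [D.norm_ϖ]
  exact inv_lt_one_of_one_lt₀ (by exact_mod_cast one_lt_card p c)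

variable [CharP K p]

/-- Coefficients of the `e i` matter only modulo `p`, so they are added separately and no carry
occurs. -/
theorem exists_digit_add (D : LocalFieldData p c K) (v w : ℕ) :
    ∃ t < p ^ c, D.digit t = D.digit v + D.digit w := by
  have hp : 0 < p := (Fact.out : p.Prime).pos
  refine ⟨finFunctionFinEquiv (m := p) (n := c) (fun i =>
    ⟨(v / p ^ (i : ℕ) % p + w / p ^ (i : ℕ) % p) % p, Nat.mod_lt _ hp⟩), Fin.is_lt _, ?_⟩
  rw [digit_finFunctionFinEquiv]
  simp only [digit]
  rw [← Finset.sum_add_distrib]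
  refine Finset.sum_congr rfl fun i _ => ?_
  rw [← add_mul, ← Nat.cast_add]
  congr 1
  exact (CharP.cast_eq_mod K p _).symm

theorem exists_lam_add (D : LocalFieldData p c K) (n m : ℕ) :
    ∃ k, D.lam k = D.lam n + D.lam m := by
  induction n using Nat.strong_induction_on generalizing m with
  | _ n ih =>
    rcases Nat.eq_zero_or_pos n with rfl | hn
    · exact ⟨m, by rw [lam_zero, zero_add]⟩
    obtain ⟨k, hk⟩ := ih (n / p ^ c) (Nat.div_lt_self hn (one_lt_card p c)) (m / p ^ c)
    obtain ⟨v, hv, hv'⟩ := D.exists_digit_add (n % p ^ c) (m % p ^ c)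
    exact ⟨v + p ^ c * k, by rw [D.lam_add_mul hv, D.lam_rec n, D.lam_rec m, hv', hk]; ring⟩

/-- The translation lattice `{λ(n)}`, a complement of the ring of integers in `K`. -/
def lattice (D : LocalFieldData p c K) : AddSubgroup K where
  carrier := Set.range D.lam
  zero_mem' := ⟨0, D.lam_zero⟩
  add_mem' := by
    rintro _ _ ⟨n, rfl⟩ ⟨m, rfl⟩
    exact D.exists_lam_add n m
  neg_mem' := by
    rintro _ ⟨n, rfl⟩
    have h : ∀ j : ℕ, j • D.lam n ∈ Set.range D.lam := fun j => by
      induction j with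
      | zero => exact ⟨0, by rw [lam_zero, zero_smul]⟩
      | succ j ih =>
        obtain ⟨k, hk⟩ := ih
        rw [succ_nsmul, ← hk]
        exact D.exists_lam_add k n
    -- In characteristic `p` negation is a multiple, so closure under addition suffices.
    have h1 : -D.lam n = (p - 1) • D.lam n := by
      rw [neg_eq_iff_add_eq_zero, ← succ_nsmul', Nat.sub_add_cancel (Fact.out : p.Prime).one_le,
        nsmul_eq_mul, CharP.cast_eq_zero, zero_mul]
    rw [h1]
    exact h _

theorem lam_mem_lattice (D : LocalFieldData p c K) (n : ℕ) : D.lam n ∈ D.lattice := ⟨n, rfl⟩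

theorem digit_pow_card (D : LocalFieldData p c K) (v : ℕ) : D.digit v ^ p ^ c = D.digit v := by
  have : ExpChar K p := ExpChar.prime (Fact.out : p.Prime)
  unfold digit
  rw [sum_pow_char_pow]
  refine Finset.sum_congr rfl fun i _ => ?_
  rw [mul_pow, D.e_pow]
  congr 1
  have := map_natCast (iterateFrobenius K p c) (v / p ^ (i : ℕ) % p)
  rwa [iterateFrobenius_def] at this

/-- A root `x` of `x^q = x` is integral. Its difference from the digit in the same residue class is
again a root, by additivity of Frobenius, and has norm `< 1`; then `‖y‖^q = ‖y‖` forces it to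
vanish. Thus the digits are exactly `GF(q)`, so products of digits are digits. -/
theorem exists_digit_eq (D : LocalFieldData p c K) {x : K} (hx : x ^ p ^ c = x) :
    ∃ v < p ^ c, D.digit v = x := by
  have : ExpChar K p := ExpChar.prime (Fact.out : p.Prime)
  have hle : ∀ y : K, y ^ p ^ c = y → ‖y‖ ≤ 1 := fun y hy => by
    by_contra! h
    have h1 := congrArg norm hy
    rw [norm_pow] at h1
    exact absurd h1 (lt_self_pow₀ h (one_lt_card p c)).ne'
  obtain ⟨v, hv, hlt⟩ := D.exists_digit_sub_lt (hle x hx)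
  refine ⟨v, hv, ?_⟩
  have hy : (x - D.digit v) ^ p ^ c = x - D.digit v := by
    rw [sub_pow_char_pow, hx, digit_pow_card]
  by_contra hne
  have hpos : 0 < ‖x - D.digit v‖ := norm_pos_iff.2 (sub_ne_zero.2 (Ne.symm hne))
  have h1 := congrArg norm hy
  rw [norm_pow] at h1
  exact absurd h1 (pow_lt_self_of_lt_one₀ hpos hlt (one_lt_card p c)).ne

theorem χ_digit_mul_zpow (D : LocalFieldData p c K) (v : ℕ) {j : ℤ} (hj : 2 ≤ j) :
    D.χ (D.digit v * (D.ϖ : K) ^ (-j)) = 1 := by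
  have h1 : ∀ i, D.χ (D.e i * (D.ϖ : K) ^ (-j)) = 1 := fun i => by
    have := D.χ_apply i j
    rw [if_neg (by omega)] at this
    exact Circle.ext (by simpa using this)
  have h2 : ∀ (S : Finset (Fin c)), D.χ (∑ i ∈ S, ((v / p ^ (i : ℕ) % p : ℕ) : K) *
      D.e i * (D.ϖ : K) ^ (-j)) = 1 := fun S => by
    induction S using Finset.cons_induction with
    | empty => simp
    | cons i S _ ih =>
      rw [Finset.sum_cons, AddChar.map_add_eq_mul, ih, mul_one, mul_assoc, ← nsmul_eq_mul,
        AddChar.map_nsmul_eq_pow, h1, one_pow]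
  rw [digit, Finset.sum_mul]
  exact h2 _

theorem χ_mul_zpow (D : LocalFieldData p c K) {x : K} (hx : x ^ p ^ c = x) {j : ℤ} (hj : 2 ≤ j) :
    D.χ (x * (D.ϖ : K) ^ (-j)) = 1 := by
  obtain ⟨v, -, rfl⟩ := D.exists_digit_eq hx
  exact D.χ_digit_mul_zpow v hj

theorem inv_ϖ_mul_zpow (D : LocalFieldData p c K) (j : ℤ) :
    (D.ϖ : K)⁻¹ * (D.ϖ : K) ^ (-j) = (D.ϖ : K) ^ (-(j + 1)) := by
  rw [← zpow_neg_one, ← zpow_add₀ D.ϖ_ne_zero]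
  congr 1
  ring

/-- Each term of `λ(n)` carries a power `ϖ^(-m)` with `m ≥ 1`, so only exponents `≤ -2` with
coefficients in `GF(q)` occur, while `χ` detects only the exponent `-1`. -/
theorem χ_lam_mul (D : LocalFieldData p c K) (n : ℕ) {x : K} (hx : x ^ p ^ c = x) {j : ℤ}
    (hj : 1 ≤ j) : D.χ (D.lam n * x * (D.ϖ : K) ^ (-j)) = 1 := by
  induction n using Nat.strong_induction_on generalizing j with
  | _ n ih =>
    rcases Nat.eq_zero_or_pos n with rfl | hn
    · simp [lam_zero]
    have h1 : D.lam n * x * (D.ϖ : K) ^ (-j) =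
        (D.digit (n % p ^ c) * x) * (D.ϖ : K) ^ (-(j + 1)) +
          D.lam (n / p ^ c) * x * (D.ϖ : K) ^ (-(j + 1)) := by
      rw [D.lam_rec n, ← inv_ϖ_mul_zpow]; ring
    rw [h1, AddChar.map_add_eq_mul, ih _ (Nat.div_lt_self hn (one_lt_card p c)) (by omega),
      mul_one]
    exact D.χ_mul_zpow (by rw [mul_pow, hx, digit_pow_card]) (by omega)

theorem χ_lam_mul_lam (D : LocalFieldData p c K) (n m : ℕ) : D.χ (D.lam n * D.lam m) = 1 := by
  -- The free power of `ϖ` absorbs the factor `ϖ⁻¹` produced by each digit removed from `λ(m)`.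
  suffices h : ∀ j : ℤ, 0 ≤ j → D.χ (D.lam n * D.lam m * (D.ϖ : K) ^ (-j)) = 1 by
    simpa using h 0 le_rfl
  induction m using Nat.strong_induction_on with
  | _ m ih =>
    intro j hj
    rcases Nat.eq_zero_or_pos m with rfl | hm
    · simp [lam_zero]
    have h1 : D.lam n * D.lam m * (D.ϖ : K) ^ (-j) =
        D.lam n * D.digit (m % p ^ c) * (D.ϖ : K) ^ (-(j + 1)) +
          D.lam n * D.lam (m / p ^ c) * (D.ϖ : K) ^ (-(j + 1)) := by
      rw [D.lam_rec m, ← inv_ϖ_mul_zpow]; ring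
    rw [h1, AddChar.map_add_eq_mul, ih _ (Nat.div_lt_self hm (one_lt_card p c)) _ (by omega),
      mul_one]
    exact D.χ_lam_mul n (D.digit_pow_card _) (by omega)

theorem χ_mul_eq_one_of_mem_lattice (D : LocalFieldData p c K) {x y : K} (hx : x ∈ D.lattice)
    (hy : y ∈ D.lattice) : D.χ (x * y) = 1 := by
  obtain ⟨n, rfl⟩ := hx
  obtain ⟨m, rfl⟩ := hy
  exact D.χ_lam_mul_lam n m

variable [IsUltrametricDist K]

theorem norm_sub_le_max_of_ultrametric {E : Type*} [SeminormedAddCommGroup E]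
    [IsUltrametricDist E] (x y : E) : ‖x - y‖ ≤ max ‖x‖ ‖y‖ := by
  simpa [sub_eq_add_neg] using IsUltrametricDist.norm_add_le_max x (-y)

theorem norm_digit_le_one (D : LocalFieldData p c K) (v : ℕ) : ‖D.digit v‖ ≤ 1 := by
  refine IsUltrametricDist.norm_sum_le_of_forall_le_of_nonneg zero_le_one fun i _ => ?_
  rw [norm_mul, D.norm_e, mul_one]
  exact IsUltrametricDist.norm_natCast_le_one K _

theorem norm_lam_le_of_lt (D : LocalFieldData p c K) {k : ℕ} (hk : k < p ^ c) :
    ‖(D.ϖ : K) * D.lam k‖ ≤ 1 := by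
  rw [D.lam_of_lt hk, mul_inv_cancel_left₀ D.ϖ_ne_zero]
  exact D.norm_digit_le_one k

/-- Digit expansion of the polar part: treat `ϖ x` by induction, then correct the integral remainder
by its residue digit. The remainder then has norm `< 1`, hence at most `‖ϖ‖`, and can be divided by
`ϖ`. -/
theorem exists_lt_pow_lam_sub_le (D : LocalFieldData p c K) (n : ℕ) :
    ∀ x : K, ‖x‖ ≤ ‖(D.ϖ : K)‖⁻¹ ^ n → ∃ k < (p ^ c) ^ n, ‖x - D.lam k‖ ≤ 1 := by
  induction n with
  | zero => exact fun x hx => ⟨0, by simp, by simpa [lam_zero] using hx⟩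
  | succ n ih =>
    intro x hx
    have hpos := D.norm_ϖ_pos
    obtain ⟨k, hk, hk'⟩ := ih ((D.ϖ : K) * x) (by
      rw [norm_mul]
      calc _ ≤ ‖(D.ϖ : K)‖ * ‖(D.ϖ : K)‖⁻¹ ^ (n + 1) := by gcongr
        _ = _ := by rw [pow_succ']; field_simp)
    obtain ⟨v, hv, hv'⟩ := D.exists_digit_sub_lt hk'
    refine ⟨v + p ^ c * k, ?_, ?_⟩
    · calc v + p ^ c * k < p ^ c + p ^ c * k := by omega
        _ = p ^ c * (k + 1) := by ring
        _ ≤ p ^ c * (p ^ c) ^ n := Nat.mul_le_mul_left _ hk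
        _ = _ := by rw [pow_succ']
    · have h1 := D.norm_le_of_lt_one _ hv'
      have h2 : (D.ϖ : K) * x - D.lam k - D.digit v =
          (D.ϖ : K) * (x - D.lam (v + p ^ c * k)) := by
        rw [D.lam_add_mul hv, mul_sub, mul_inv_cancel_left₀ D.ϖ_ne_zero]; ring
      rw [h2, norm_mul] at h1
      exact le_of_mul_le_mul_left (by simpa using h1) hpos

theorem exists_lam_sub_le (D : LocalFieldData p c K) (x : K) : ∃ k, ‖x - D.lam k‖ ≤ 1 := by
  obtain ⟨n, hn⟩ := pow_unbounded_of_one_lt ‖x‖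
    ((one_lt_inv₀ D.norm_ϖ_pos).2 D.norm_ϖ_lt_one)
  obtain ⟨k, -, hk⟩ := D.exists_lt_pow_lam_sub_le n x hn.le
  exact ⟨k, hk⟩

theorem exists_lt_lam_sub_le (D : LocalFieldData p c K) {x : K} (hx : ‖(D.ϖ : K) * x‖ ≤ 1) :
    ∃ k < p ^ c, ‖x - D.lam k‖ ≤ 1 := by
  have := D.exists_lt_pow_lam_sub_le 1 x (by
    rw [norm_mul, mul_comm] at hx
    rw [pow_one, ← one_div]
    exact (le_div_iff₀ D.norm_ϖ_pos).2 hx)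
  simpa using this

theorem digit_eq_of_norm_sub_lt (D : LocalFieldData p c K) {v w : ℕ} (hv : v < p ^ c)
    (hw : w < p ^ c) (h : ‖D.digit v - D.digit w‖ < 1) : v = w := by
  obtain ⟨u, -, hu⟩ := D.existsUnique_residue (D.digit v) (D.norm_digit_le_one v)
  have key : ∀ t (ht : t < p ^ c), ‖D.digit v - D.digit t‖ < 1 →
      t = (finFunctionFinEquiv u : ℕ) := fun t ht hlt => by
    have h1 : finFunctionFinEquiv.symm (⟨t, ht⟩ : Fin (p ^ c)) = u := hu _ (by
      dsimp only
      rw [← digit_finFunctionFinEquiv, Equiv.apply_symm_apply]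
      exact hlt)
    rw [← h1, Equiv.apply_symm_apply]
  rw [key v hv (by simp), key w hw h]

/-- Multiplying by `ϖ` makes the difference `< 1` and exposes the lowest digits. These are integral,
so the tails differ by an integral element and agree by induction; the digits are then congruent,
hence equal. -/
theorem lam_eq_of_norm_sub_le (D : LocalFieldData p c K) {n m : ℕ}
    (h : ‖D.lam n - D.lam m‖ ≤ 1) : n = m := by
  induction hN : n + m using Nat.strong_induction_on generalizing n m with
  | _ N ih =>
    by_cases h0 : n + m = 0
    · omega
    have hq := one_lt_card p c
    have hlt : n / p ^ c + m / p ^ c < N := by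
      rcases Nat.eq_zero_or_pos n with rfl | hn
      · have := Nat.div_lt_self (show 0 < m by omega) hq
        simpa [← hN] using this
      · have := Nat.div_lt_self hn hq
        have := Nat.div_le_self m (p ^ c)
        omega
    have h1 : ‖D.digit (n % p ^ c) - D.digit (m % p ^ c) +
        (D.lam (n / p ^ c) - D.lam (m / p ^ c))‖ < 1 := by
      have e1 : D.digit (n % p ^ c) - D.digit (m % p ^ c) +
          (D.lam (n / p ^ c) - D.lam (m / p ^ c)) = (D.ϖ : K) * (D.lam n - D.lam m) := by
        rw [D.lam_rec n, D.lam_rec m, ← mul_sub, mul_inv_cancel_left₀ D.ϖ_ne_zero]; ring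
      rw [e1, norm_mul]
      calc _ ≤ ‖(D.ϖ : K)‖ * 1 := by gcongr
        _ < 1 := by simpa using D.norm_ϖ_lt_one
    have h2 : ‖D.digit (n % p ^ c) - D.digit (m % p ^ c)‖ ≤ 1 :=
      (norm_sub_le_max_of_ultrametric _ _).trans
        (max_le (D.norm_digit_le_one _) (D.norm_digit_le_one _))
    have h3 : n / p ^ c = m / p ^ c := by
      refine ih _ hlt ?_ rfl
      rw [← add_sub_cancel_left (D.digit (n % p ^ c) - D.digit (m % p ^ c))
        (D.lam (n / p ^ c) - D.lam (m / p ^ c))]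
      exact (norm_sub_le_max_of_ultrametric _ _).trans (max_le h1.le h2)
    rw [h3, sub_self, add_zero] at h1
    have h4 := D.digit_eq_of_norm_sub_lt (Nat.mod_lt _ (by omega)) (Nat.mod_lt _ (by omega)) h1
    rw [← Nat.div_add_mod n (p ^ c), ← Nat.div_add_mod m (p ^ c), h3, h4]

theorem lam_eq_zero_iff (D : LocalFieldData p c K) {n : ℕ} : D.lam n = 0 ↔ n = 0 :=
  ⟨fun h => D.lam_eq_of_norm_sub_le (by simp [h, lam_zero]), fun h => by rw [h, lam_zero]⟩

theorem eq_zero_of_mem_lattice (D : LocalFieldData p c K) {x : K} (hx : x ∈ D.lattice)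
    (h : ‖x‖ ≤ 1) : x = 0 := by
  obtain ⟨n, rfl⟩ := hx
  rw [lam_eq_zero_iff]
  exact D.lam_eq_of_norm_sub_le (by simpa [lam_zero] using h)

end Lattice

/-! ### Reduction modulo the lattice. -/

section Fold

variable {p c : ℕ} [NeZero c] {K : Type*} [NontriviallyNormedField K] [Fact p.Prime] [CharP K p]
  [IsUltrametricDist K]

/-- The point of the ring of integers in the same class as `x` modulo the lattice. -/
noncomputable def fold (D : LocalFieldData p c K) (x : K) : K :=
  x - D.lam (D.exists_lam_sub_le x).choose

theorem norm_fold_le_one (D : LocalFieldData p c K) (x : K) : ‖D.fold x‖ ≤ 1 :=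
  (D.exists_lam_sub_le x).choose_spec

theorem sub_fold_mem (D : LocalFieldData p c K) (x : K) : x - D.fold x ∈ D.lattice := by
  rw [fold, sub_sub_cancel]
  exact D.lam_mem_lattice _

theorem fold_eq_of_mem (D : LocalFieldData p c K) {x y : K} (hy : ‖y‖ ≤ 1)
    (h : x - y ∈ D.lattice) : D.fold x = y := by
  have h1 := D.eq_zero_of_mem_lattice (D.lattice.sub_mem h (D.sub_fold_mem x)) (by
    rw [show x - y - (x - D.fold x) = D.fold x - y by ring]
    exact (norm_sub_le_max_of_ultrametric _ _).trans (max_le (D.norm_fold_le_one x) hy))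
  rw [← sub_eq_zero, ← h1]
  ring

theorem fold_eq_self (D : LocalFieldData p c K) {x : K} (hx : ‖x‖ ≤ 1) : D.fold x = x :=
  D.fold_eq_of_mem hx (by rw [sub_self]; exact D.lattice.zero_mem)

theorem fold_add_of_norm_le_one (D : LocalFieldData p c K) (x : K) {h : K} (hh : ‖h‖ ≤ 1) :
    D.fold (x + h) = D.fold x + h :=
  D.fold_eq_of_mem ((IsUltrametricDist.norm_add_le_max _ _).trans
      (max_le (D.norm_fold_le_one x) hh)) (by
    rw [add_sub_add_right_eq_sub]
    exact D.sub_fold_mem x)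

/-- Integral shifts commute with folding, so `fold` is a translation on every ball of radius `1`. -/
theorem continuous_fold (D : LocalFieldData p c K) : Continuous D.fold := by
  rw [continuous_iff_continuousAt]
  intro x
  have h1 : D.fold =ᶠ[𝓝 x] fun y => D.fold x + (y - x) := by
    filter_upwards [Metric.closedBall_mem_nhds x one_pos] with y hy
    have := D.fold_add_of_norm_le_one x (h := y - x) (by simpa [dist_eq_norm] using hy)
    rwa [add_sub_cancel] at this
  exact (continuousAt_const.add (continuousAt_id.sub continuousAt_const)).congr h1.symm

theorem χ_fold_mul (D : LocalFieldData p c K) {l : K} (hl : l ∈ D.lattice) (x : K) :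
    D.χ (D.fold x * l) = D.χ (x * l) := by
  have h1 : x * l = D.fold x * l + (x - D.fold x) * l := by ring
  rw [h1, AddChar.map_add_eq_mul, D.χ_mul_eq_one_of_mem_lattice (D.sub_fold_mem x) hl, mul_one]

end Fold
end LocalFieldData

instance properSpace_of_locallyCompactSpace_self (K : Type*) [NontriviallyNormedField K]
    [LocallyCompactSpace K] : ProperSpace K := ProperSpace.of_locallyCompactSpace K

namespace LocalFieldData

/-! ### Finite measures are determined by their Fourier transforms. -/

section Uniqueness

variable {p c : ℕ} [NeZero c] {K : Type*} [NontriviallyNormedField K] [Fact p.Prime]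

theorem continuous_χ (D : LocalFieldData p c K) : Continuous fun x => (D.χ x : ℂ) :=
  continuous_subtype_val.comp D.isLocallyConstant_χ.continuous

/-- The character `x ↦ χ(x ξ)` as a bounded continuous function. -/
noncomputable def χBdd (D : LocalFieldData p c K) (ξ : K) : K →ᵇ ℂ :=
  BoundedContinuousFunction.ofNormedAddCommGroup (fun x => (D.χ (x * ξ) : ℂ))
    (D.continuous_χ.comp (continuous_mul_const ξ)) 1 fun _ => (Circle.norm_coe _).le

theorem χBdd_apply (D : LocalFieldData p c K) (ξ x : K) : D.χBdd ξ x = (D.χ (x * ξ) : ℂ) := rfl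

theorem χBdd_mul (D : LocalFieldData p c K) (ξ η : K) :
    D.χBdd ξ * D.χBdd η = D.χBdd (ξ + η) := by
  ext x
  simp [χBdd_apply, mul_add, AddChar.map_add_eq_mul]

theorem star_χBdd (D : LocalFieldData p c K) (ξ : K) : star (D.χBdd ξ) = D.χBdd (-ξ) := by
  ext x
  simp [χBdd_apply, AddChar.map_neg_eq_inv, ← Circle.coe_inv_eq_conj]

theorem exists_χ_mul_ne_one (D : LocalFieldData p c K) {x : K} (hx : x ≠ 0) :
    ∃ ξ, D.χ (x * ξ) ≠ 1 :=
  ⟨x⁻¹ * (D.ϖ : K)⁻¹, by rw [mul_inv_cancel_left₀ hx]; exact D.χ_inv_ϖ_ne_one⟩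

variable [LocallyCompactSpace K] [MeasurableSpace K] [BorelSpace K]

theorem aestronglyMeasurable_χ_mul (D : LocalFieldData p c K) (ξ : K) (μ : Measure K) :
    AEStronglyMeasurable (fun x => (D.χ (x * ξ) : ℂ)) μ :=
  (D.χBdd ξ).continuous.aestronglyMeasurable

/-- A finite measure on `K` is determined by its Fourier transform. -/
theorem measure_ext_of_integral_χ (D : LocalFieldData p c K) {P P' : Measure K}
    [IsFiniteMeasure P] [IsFiniteMeasure P']
    (h : ∀ ξ, ∫ x, (D.χ (x * ξ) : ℂ) ∂P = ∫ x, (D.χ (x * ξ) : ℂ) ∂P') : P = P' := by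
  -- The characters are closed under products and conjugation, so the star algebra they generate is
  -- their linear span. It separates points, and a separating star algebra determines finite
  -- measures.
  have hcl : (Submonoid.closure (Set.range D.χBdd ∪ star (Set.range D.χBdd)) : Set (K →ᵇ ℂ)) ⊆
      Set.range D.χBdd := by
    intro f hf
    induction hf using Submonoid.closure_induction with
    | mem f hf =>
      rcases hf with hf | ⟨ξ, hξ⟩
      · exact hf
      · exact ⟨-ξ, by rw [← star_χBdd, hξ, star_star]⟩
    | one => exact ⟨0, by ext x; simp [χBdd_apply]⟩
    | mul f g _ _ hf hg =>
      obtain ⟨ξ, rfl⟩ := hf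
      obtain ⟨η, rfl⟩ := hg
      exact ⟨ξ + η, (D.χBdd_mul ξ η).symm⟩
  refine ext_of_forall_mem_subalgebra_integral_eq_of_pseudoEMetric_complete_countable (𝕜 := ℂ)
    (A := StarAlgebra.adjoin ℂ (Set.range D.χBdd)) ?_ ?_
  · intro x y hxy
    obtain ⟨ξ, hξ⟩ := D.exists_χ_mul_ne_one (sub_ne_zero.2 hxy)
    refine ⟨_, ⟨_, ⟨D.χBdd ξ, StarAlgebra.subset_adjoin ℂ _ ⟨ξ, rfl⟩, rfl⟩, rfl⟩, ?_⟩
    intro heq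
    apply hξ
    have h1 : D.χ (x * ξ) = D.χ (y * ξ) := Circle.ext heq
    rw [sub_mul, AddChar.map_sub_eq_div, h1, div_self']
  · intro g hg
    have hg' : g ∈ Submodule.span ℂ (Set.range D.χBdd) := by
      refine Submodule.span_mono hcl ?_
      rw [← StarAlgebra.adjoin_eq_span]
      exact hg
    clear hg
    induction hg' using Submodule.span_induction with
    | mem f hf => obtain ⟨ξ, rfl⟩ := hf; exact h ξ
    | zero => simp
    | add f g hf hg ihf ihg =>
      simp only [BoundedContinuousFunction.coe_add, Pi.add_apply]
      rw [integral_add (f.integrable P) (g.integrable P),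
        integral_add (f.integrable P') (g.integrable P'), ihf, ihg]
    | smul a f hf ihf =>
      simp only [BoundedContinuousFunction.coe_smul, integral_smul, ihf]

end Uniqueness

/-! ### Fourier uniqueness for functions, dilation of Haar measure, periodization. -/

section Haar

variable {p c : ℕ} [NeZero c] {K : Type*} [NontriviallyNormedField K] [Fact p.Prime]
  [LocallyCompactSpace K] [MeasurableSpace K] [BorelSpace K]

/-- An integrable function whose Fourier transform vanishes is zero almost everywhere. -/
theorem ae_eq_zero_of_integral_mul_χ_eq_zero_real (D : LocalFieldData p c K) {h : K → ℝ}
    (hh : Integrable h (haarK K)) (H : ∀ ξ, ∫ x, (h x : ℂ) * (D.χ (x * ξ) : ℂ) ∂(haarK K) = 0) :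
    h =ᵐ[haarK K] 0 := by
  have hfin : ∀ f : K → ℝ, Integrable f (haarK K) →
      IsFiniteMeasure ((haarK K).withDensity fun x => ((f x).toNNReal : ℝ≥0∞)) := fun f hf =>
    isFiniteMeasure_withDensity_ofReal hf.2
  have i1 := hfin h hh
  have i2 := hfin (-h) hh.neg
  have hm1 : AEMeasurable (fun x => (h x).toNNReal) (haarK K) := hh.1.aemeasurable.real_toNNReal
  have hm2 : AEMeasurable (fun x => ((-h) x).toNNReal) (haarK K) :=
    hh.neg.1.aemeasurable.real_toNNReal
  have hχ : ∀ ξ, ∀ μ : Measure K, ∀ f : K → ℝ, Integrable f μ →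
      Integrable (fun x => (f x).toNNReal • (D.χ (x * ξ) : ℂ)) μ := fun ξ μ f hf => by
    have h1 : Integrable (fun x => ((f x).toNNReal : ℝ)) μ := hf.real_toNNReal
    exact h1.ofReal.mul_bdd (c := 1) (D.aestronglyMeasurable_χ_mul ξ _)
      (Eventually.of_forall fun x => (Circle.norm_coe _).le)
  -- The positive and negative parts of `h` are densities of finite measures with equal Fourier
  -- transforms.
  have key := D.measure_ext_of_integral_χ (P := (haarK K).withDensity fun x => (h x).toNNReal)
    (P' := (haarK K).withDensity fun x => ((-h) x).toNNReal) fun ξ => by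
      rw [integral_withDensity_eq_integral_smul₀ hm1, integral_withDensity_eq_integral_smul₀ hm2,
        ← sub_eq_zero, ← integral_sub (hχ ξ _ _ hh) (hχ ξ _ _ hh.neg), ← H ξ]
      congr 1
      funext x
      simp only [NNReal.smul_def, Complex.real_smul, ← sub_mul, Pi.neg_apply]
      rw [← Complex.ofReal_sub, Real.coe_toNNReal', Real.coe_toNNReal',
        max_zero_sub_max_neg_zero_eq_self]
  rw [withDensity_eq_iff hm1.coe_nnreal_ennreal hm2.coe_nnreal_ennreal] at key
  · filter_upwards [key] with x hx
    have h2 : (h x).toNNReal = (-h x).toNNReal := by exact_mod_cast hx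
    rw [Pi.zero_apply, ← max_zero_sub_max_neg_zero_eq_self (h x), ← Real.coe_toNNReal',
      ← Real.coe_toNNReal', h2, sub_self]
  · simpa using i1.measure_univ_lt_top.ne

/-- The transform of `conj h` at `ξ` is the conjugate of that of `h` at `-ξ`, so the transforms of
the real and imaginary parts vanish as well. -/
theorem ae_eq_zero_of_integral_mul_χ_eq_zero (D : LocalFieldData p c K) {h : K → ℂ}
    (hh : Integrable h (haarK K)) (H : ∀ ξ, ∫ x, h x * (D.χ (x * ξ) : ℂ) ∂(haarK K) = 0) :
    h =ᵐ[haarK K] 0 := by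
  have hint : ∀ (g : K → ℂ), Integrable g (haarK K) → ∀ ξ,
      Integrable (fun x => g x * (D.χ (x * ξ) : ℂ)) (haarK K) := fun g hg ξ =>
    hg.mul_bdd (c := 1) (D.aestronglyMeasurable_χ_mul ξ _)
      (Eventually.of_forall fun x => (Circle.norm_coe _).le)
  have hstar : Integrable (fun x => starRingEnd ℂ (h x)) (haarK K) :=
    hh.mono (Complex.continuous_conj.comp_aestronglyMeasurable hh.1)
      (Eventually.of_forall fun x => by simp)
  have Hc : ∀ ξ, ∫ x, starRingEnd ℂ (h x) * (D.χ (x * ξ) : ℂ) ∂(haarK K) = 0 := fun ξ => by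
    have h1 := congrArg (starRingEnd ℂ) (H (-ξ))
    rw [← integral_conj, map_zero] at h1
    rw [← h1]
    congr 1
    funext x
    rw [map_mul (starRingEnd ℂ), ← Circle.coe_inv_eq_conj, mul_neg, AddChar.map_neg_eq_inv, inv_inv]
  have hre := D.ae_eq_zero_of_integral_mul_χ_eq_zero_real hh.re fun ξ => by
    have h1 : ∀ x, ((h x).re : ℂ) * (D.χ (x * ξ) : ℂ) =
        2⁻¹ * (h x * (D.χ (x * ξ) : ℂ) + starRingEnd ℂ (h x) * (D.χ (x * ξ) : ℂ)) := fun x => by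
      have := Complex.re_eq_add_conj (h x)
      rw [this]
      ring
    simp only [RCLike.re_to_complex, h1]
    rw [integral_const_mul, integral_add (hint _ hh ξ) (hint _ hstar ξ), H, Hc, add_zero, mul_zero]
  have him := D.ae_eq_zero_of_integral_mul_χ_eq_zero_real hh.im fun ξ => by
    have h1 : ∀ x, ((h x).im : ℂ) * (D.χ (x * ξ) : ℂ) =
        (2 * Complex.I)⁻¹ * (h x * (D.χ (x * ξ) : ℂ) - starRingEnd ℂ (h x) * (D.χ (x * ξ) : ℂ)) :=
      fun x => by
        have := Complex.im_eq_sub_conj (h x)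
        rw [this]
        ring
    simp only [RCLike.im_to_complex, h1]
    rw [integral_const_mul, integral_sub (hint _ hh ξ) (hint _ hstar ξ), H, Hc, sub_zero, mul_zero]
  filter_upwards [hre, him] with x h1 h2
  exact Complex.ext h1 h2

variable [IsUltrametricDist K]

/-- A character which is not trivial on the ring of integers has integral zero over every ball
around the origin which contains the ring of integers. -/
theorem setIntegral_χ_eq_zero (D : LocalFieldData p c K) {b : K} (hb : 1 < ‖b‖) {R : ℝ}
    (hR : 1 ≤ R) : ∫ x in Metric.closedBall 0 R, (D.χ (x * b) : ℂ) ∂(haarK K) = 0 := by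
  have hb0 : b ≠ 0 := norm_pos_iff.1 (zero_lt_one.trans hb)
  have hϖ : ‖b⁻¹‖ ≤ ‖(D.ϖ : K)‖ := D.norm_le_of_lt_one _ (by
    rw [norm_inv]; exact inv_lt_one_of_one_lt₀ hb)
  -- Chosen so that `t b = ϖ⁻¹`. Since `t` is integral, translation by it preserves the ball and
  -- multiplies the integral by `χ(ϖ⁻¹) ≠ 1`.
  set t := (D.ϖ : K)⁻¹ * b⁻¹ with ht
  have htn : ‖t‖ ≤ 1 := by
    rw [ht, norm_mul, norm_inv, inv_mul_le_iff₀ D.norm_ϖ_pos, mul_one]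
    exact hϖ
  have hmem : ∀ x, x + t ∈ Metric.closedBall (0 : K) R ↔ x ∈ Metric.closedBall (0 : K) R :=
    fun x => by
      simp only [mem_closedBall_zero_iff]
      constructor <;> intro h
      · rw [← add_sub_cancel_right x t]
        exact (norm_sub_le_max_of_ultrametric _ _).trans (max_le h (htn.trans hR))
      · exact (IsUltrametricDist.norm_add_le_max _ _).trans (max_le h (htn.trans hR))
  have h1 : ∫ x in Metric.closedBall 0 R, (D.χ (x * b) : ℂ) ∂(haarK K) =
      (D.χ (D.ϖ : K)⁻¹ : ℂ) * ∫ x in Metric.closedBall 0 R, (D.χ (x * b) : ℂ) ∂(haarK K) := by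
    rw [← integral_const_mul, ← integral_indicator Metric.isClosed_closedBall.measurableSet,
      ← integral_indicator Metric.isClosed_closedBall.measurableSet,
      ← integral_add_right_eq_self _ t]
    congr 1
    funext x
    by_cases hx : x ∈ Metric.closedBall (0 : K) R
    · rw [Set.indicator_of_mem ((hmem x).2 hx), Set.indicator_of_mem hx, add_mul,
        AddChar.map_add_eq_mul, Circle.coe_mul, mul_comm]
      congr 3
      rw [ht, mul_assoc, inv_mul_cancel₀ hb0, mul_one]
    · rw [Set.indicator_of_notMem (mt (hmem x).1 hx), Set.indicator_of_notMem hx]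
  by_contra hne
  exact D.χ_inv_ϖ_ne_one (Circle.ext (mul_right_cancel₀ hne (h1.symm.trans (one_mul _).symm)))

theorem haarK_closedBall_one : haarK K (Metric.closedBall 0 1) = 1 :=
  Measure.addHaarMeasure_self (K₀ := ringOfIntegersCompacts K)

variable [CharP K p]

/-- The `λ(k)` with `k < q` represent `ϖ⁻¹𝒟 / 𝒟`. This partition gives the scaling factor of Haar
measure under `ϖ` and, multiplied by `ϖ`, the columns of the filter matrix. -/
theorem setOf_norm_ϖ_mul_le (D : LocalFieldData p c K) :
    {x : K | ‖(D.ϖ : K) * x‖ ≤ 1} =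
      ⋃ k : Fin (p ^ c), (fun x => D.lam k + x) '' Metric.closedBall 0 1 := by
  ext x
  simp only [Set.mem_ofPred_eq, Set.mem_iUnion, Set.mem_image, mem_closedBall_zero_iff]
  constructor
  · intro hx
    obtain ⟨k, hk, hk'⟩ := D.exists_lt_lam_sub_le hx
    exact ⟨⟨k, hk⟩, x - D.lam k, hk', by simp⟩
  · rintro ⟨k, y, hy, rfl⟩
    rw [mul_add]
    refine (IsUltrametricDist.norm_add_le_max _ _).trans (max_le (D.norm_lam_le_of_lt k.2) ?_)
    rw [norm_mul]
    exact mul_le_one₀ D.norm_ϖ_lt_one.le (norm_nonneg _) hy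

theorem pairwise_disjoint_lam_add (D : LocalFieldData p c K) :
    Pairwise (Function.onFun Disjoint fun k : ℕ =>
      (fun x => D.lam k + x) '' Metric.closedBall 0 1) := by
  intro k k' hkk
  rw [Function.onFun, Set.disjoint_left]
  rintro _ ⟨y, hy, rfl⟩ ⟨y', hy', h⟩
  rw [mem_closedBall_zero_iff] at hy hy'
  refine hkk (D.lam_eq_of_norm_sub_le ?_)
  have h' : D.lam k - D.lam k' = y' - y := by
    linear_combination -h
  rw [h']
  exact (norm_sub_le_max_of_ultrametric _ _).trans (max_le hy' hy)

theorem map_ϖ_mul_haarK (D : LocalFieldData p c K) :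
    (haarK K).map (fun x => (D.ϖ : K) * x) = ((p ^ c : ℕ) : ℝ≥0) • haarK K := by
  have hH : ((haarK K).map (fun x => (D.ϖ : K) * x)).IsAddHaarMeasure :=
    (AddEquiv.mk' (Equiv.mulLeft₀ _ D.ϖ_ne_zero) fun x y => mul_add _ x y).isAddHaarMeasure_map
      (haarK K) (continuous_const_mul _) (continuous_const_mul _)
  have h1 := Measure.addHaarMeasure_unique ((haarK K).map (fun x => (D.ϖ : K) * x))
    (ringOfIntegersCompacts K)
  rw [h1]
  change _ • haarK K = _
  have h2 : (haarK K).map (fun x => (D.ϖ : K) * x) (ringOfIntegersCompacts K) =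
      ((p ^ c : ℕ) : ℝ≥0) := by
    rw [Measure.map_apply (measurable_const_mul _)
      (ringOfIntegersCompacts K).isCompact.measurableSet]
    have : (fun x => (D.ϖ : K) * x) ⁻¹' (ringOfIntegersCompacts K) =
        {x : K | ‖(D.ϖ : K) * x‖ ≤ 1} := by
      ext x
      exact mem_closedBall_zero_iff
    rw [this, setOf_norm_ϖ_mul_le, measure_iUnion]
    · have : ∀ k : ℕ, haarK K ((fun x => D.lam k + x) '' Metric.closedBall 0 1) = 1 := fun k => by
        rw [Set.image_add_left, measure_preimage_add, haarK_closedBall_one]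
      simp only [this]
      simp
    · exact fun k k' hkk => D.pairwise_disjoint_lam_add (Fin.val_ne_of_ne hkk)
    · intro k
      rw [Set.image_add_left]
      exact measurable_const_add _ Metric.isClosed_closedBall.measurableSet
  rw [h2]
  rfl

theorem map_zpow_ϖ_mul_haarK (D : LocalFieldData p c K) (n : ℤ) :
    (haarK K).map (fun x => (D.ϖ : K) ^ n * x) = ((p ^ c : ℕ) : ℝ≥0) ^ n • haarK K := by
  have hq : ((p ^ c : ℕ) : ℝ≥0) ≠ 0 := by
    exact_mod_cast (zero_lt_one.trans (one_lt_card p c)).ne'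
  have hcomp : ∀ m n : ℤ, (haarK K).map (fun x => (D.ϖ : K) ^ (n + m) * x) =
      ((haarK K).map (fun x => (D.ϖ : K) ^ n * x)).map (fun x => (D.ϖ : K) ^ m * x) := fun m n => by
    rw [Measure.map_map (measurable_const_mul _) (measurable_const_mul _)]
    congr 1
    funext x
    rw [Function.comp_apply, zpow_add₀ D.ϖ_ne_zero]
    ring
  have hone : (haarK K).map (fun x => (D.ϖ : K) ^ (1 : ℤ) * x) =
      ((p ^ c : ℕ) : ℝ≥0) • haarK K := by
    simpa using D.map_ϖ_mul_haarK
  have hneg : (haarK K).map (fun x => (D.ϖ : K) ^ (-1 : ℤ) * x) =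
      ((p ^ c : ℕ) : ℝ≥0)⁻¹ • haarK K := by
    have := hcomp (-1) 1
    rw [hone, Measure.map_smul] at this
    simp only [add_neg_cancel, zpow_zero, one_mul, Measure.map_id'] at this
    conv_rhs => rw [this]
    rw [smul_smul, inv_mul_cancel₀ hq, one_smul]
  induction n using Int.induction_on with
  | zero => simp
  | succ n ih =>
    rw [hcomp, ih, Measure.map_smul, hone, smul_smul, zpow_add₀ hq, zpow_one]
  | pred n ih =>
    rw [sub_eq_add_neg, hcomp, ih, Measure.map_smul, hneg, smul_smul, zpow_add₀ hq, zpow_neg_one]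

theorem integral_χ_ringOfIntegers (D : LocalFieldData p c K) (b : K) :
    ∫ x in Metric.closedBall 0 1, (D.χ (x * b) : ℂ) ∂(haarK K) = if ‖b‖ ≤ 1 then 1 else 0 := by
  split_ifs with hb
  · have : ∀ x ∈ Metric.closedBall (0 : K) 1, (D.χ (x * b) : ℂ) = 1 := fun x hx => by
      rw [D.χ_eq_one, Circle.coe_one]
      rw [norm_mul]
      exact mul_le_one₀ (mem_closedBall_zero_iff.1 hx) (norm_nonneg _) hb
    rw [setIntegral_congr_fun Metric.isClosed_closedBall.measurableSet this]
    simp [Measure.real, haarK_closedBall_one]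
  · exact D.setIntegral_χ_eq_zero (not_le.1 hb) le_rfl

instance isFiniteMeasure_haarK_restrict_closedBall (x : K) (R : ℝ) :
    IsFiniteMeasure ((haarK K).restrict (Metric.closedBall x R)) :=
  ⟨by rw [Measure.restrict_apply_univ]; exact (isCompact_closedBall x R).measure_lt_top⟩

/-- A finite measure whose Fourier transform on the lattice vanishes away from the origin has
constant periodization. -/
theorem map_fold (D : LocalFieldData p c K) {μ : Measure K} [IsFiniteMeasure μ] {r : ℝ≥0}
    (h : ∀ k, ∫ x, (D.χ (x * D.lam k) : ℂ) ∂μ = if k = 0 then ((r : ℝ) : ℂ) else 0) :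
    μ.map D.fold = r • (haarK K).restrict (Metric.closedBall 0 1) := by
  refine D.measure_ext_of_integral_χ fun ξ => ?_
  -- On the ring of integers the character of `ξ` equals that of a lattice point, so the lattice
  -- frequencies determine the folded measure.
  obtain ⟨k, hk⟩ := D.exists_lam_sub_le ξ
  have hχ : ∀ x : K, ‖x‖ ≤ 1 → D.χ (x * ξ) = D.χ (x * D.lam k) := fun x hx => by
    have h1 : x * ξ = x * D.lam k + x * (ξ - D.lam k) := by ring
    rw [h1, D.χ_add_eq]
    rw [norm_mul]
    exact mul_le_one₀ hx (norm_nonneg _) hk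
  rw [integral_map D.continuous_fold.aemeasurable (D.aestronglyMeasurable_χ_mul ξ _)]
  have h1 : ∀ x, (D.χ (D.fold x * ξ) : ℂ) = D.χ (x * D.lam k) := fun x => by
    rw [hχ _ (D.norm_fold_le_one x), D.χ_fold_mul (D.lam_mem_lattice k)]
  simp only [h1]
  rw [h k, integral_smul_nnreal_measure, setIntegral_congr_fun (g := fun x => (D.χ (x * D.lam k) : ℂ))
    Metric.isClosed_closedBall.measurableSet
    (fun x hx => by rw [hχ x (mem_closedBall_zero_iff.1 hx)]), integral_χ_ringOfIntegers]
  have h2 : ‖D.lam k‖ ≤ 1 ↔ k = 0 :=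
    ⟨fun h => D.lam_eq_of_norm_sub_le (by simpa [lam_zero] using h),
      fun h => by simp [h, lam_zero]⟩
  simp only [h2]
  split_ifs <;> simp [NNReal.smul_def]

/-- Nontrivial lattice characters integrate to zero over these balls. This carries `L²` estimates
for periodic functions from the ring of integers to every ball. -/
theorem map_fold_closedBall (D : LocalFieldData p c K) {R : ℝ} (hR : 1 ≤ R) :
    ((haarK K).restrict (Metric.closedBall 0 R)).map D.fold =
      (haarK K (Metric.closedBall 0 R)).toNNReal •
        (haarK K).restrict (Metric.closedBall 0 1) := by
  refine D.map_fold fun k => ?_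
  split_ifs with hk
  · rw [hk, lam_zero]
    simp [Measure.real, ENNReal.toReal]
  · refine D.setIntegral_χ_eq_zero ?_ hR
    by_contra! h
    exact hk (D.lam_eq_of_norm_sub_le (by simpa [lam_zero] using h))

end Haar

end LocalFieldData

theorem TemperedDistr.affine_inv_affine {K : Type*} [NontriviallyNormedField K]
    (f : TemperedDistr K) (a : Kˣ) : (f.affine a 0).affine a⁻¹ 0 = f := by
  ext θ
  have h1 : SchwartzBruhat.affine a 0 (SchwartzBruhat.affine a⁻¹ 0 θ) = θ := by
    ext x
    simp [SchwartzBruhat.affine]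
  have h2 : ‖(a : K)‖ ≠ 0 := norm_ne_zero_iff.2 a.ne_zero
  rw [TemperedDistr.affine, TemperedDistr.affine, LinearMap.smul_apply, LinearMap.comp_apply,
    LinearMap.smul_apply, LinearMap.comp_apply, h1, smul_smul, ← Complex.ofReal_mul,
    Units.val_inv_eq_inv_val, norm_inv, inv_inv, mul_inv_cancel₀ h2, Complex.ofReal_one, one_smul]

namespace LocalFieldData

/-! ### Fourier transforms of distributions under translation and dilation. -/

section Distributions

variable {p c : ℕ} [NeZero c] {K : Type*} [NontriviallyNormedField K] [Fact p.Prime]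
  [LocallyCompactSpace K] [MeasurableSpace K] [BorelSpace K]

theorem fourierTest_apply (D : LocalFieldData p c K) (θ : SchwartzBruhat K) (ξ : K) :
    (D.fourierTest θ : K → ℂ) ξ = ∫ x, (D.χ (-(x * ξ)) : ℂ) * (θ : K → ℂ) x ∂(haarK K) := rfl

theorem fourierTest_injective (D : LocalFieldData p c K) : Function.Injective D.fourierTest := by
  rw [injective_iff_map_eq_zero]
  intro θ hθ
  have h1 := D.ae_eq_zero_of_integral_mul_χ_eq_zero (integrable_schwartzBruhat θ) fun ξ => by
    have h2 := D.fourierTest_apply θ (-ξ)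
    rw [hθ] at h2
    simp only [mul_neg, neg_neg] at h2
    rw [show (∫ x, (θ : K → ℂ) x * (D.χ (x * ξ) : ℂ) ∂(haarK K)) = _ from
      integral_congr_ae (Eventually.of_forall fun x => mul_comm _ _), ← h2]
    rfl
  exact Subtype.ext ((θ.2.1.continuous.ae_eq_iff_eq (haarK K) continuous_const).1 h1)

theorem integrable_mul_schwartzBruhat {g : K → ℂ} (hg : LocallyIntegrable g (haarK K))
    (θ : SchwartzBruhat K) : Integrable (fun x => g x * (θ : K → ℂ) x) (haarK K) :=
  hg.integrable_smul_right_of_hasCompactSupport θ.2.1.continuous θ.2.2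

/-- Every locally integrable function is the Fourier transform of a tempered distribution. -/
theorem exists_hasFourier (D : LocalFieldData p c K) {g : K → ℂ}
    (hg : LocallyIntegrable g (haarK K)) : ∃ f, D.HasFourier f g := by
  -- Distributions are arbitrary linear functionals, so an algebraic left inverse of the Fourier
  -- transform is enough; Fourier inversion is not needed.
  obtain ⟨L, hL⟩ := D.fourierTest.exists_leftInverse_of_injective
    (LinearMap.ker_eq_bot.2 D.fourierTest_injective)
  let G : SchwartzBruhat K →ₗ[ℂ] ℂ :=
    { toFun θ := ∫ ξ, g ξ * (θ : K → ℂ) ξ ∂(haarK K)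
      map_add' θ η := by
        simp only [Submodule.coe_add, Pi.add_apply, mul_add]
        exact integral_add (integrable_mul_schwartzBruhat hg θ)
          (integrable_mul_schwartzBruhat hg η)
      map_smul' a θ := by
        simp only [Submodule.coe_smul, Pi.smul_apply, smul_eq_mul, RingHom.id_apply,
          mul_left_comm _ a]
        exact integral_const_mul _ _ }
  refine ⟨G.comp L, hg, fun θ => ?_⟩
  have h1 : L (D.fourierTest θ) = θ := LinearMap.congr_fun hL θ
  rw [LinearMap.comp_apply, h1]
  rfl

theorem hasFourier_invHat (D : LocalFieldData p c K) {g : K → ℂ}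
    (hg : LocallyIntegrable g (haarK K)) : D.HasFourier (D.invHat g) g := by
  rw [invHat, dif_pos (D.exists_hasFourier hg)]
  exact (D.exists_hasFourier hg).choose_spec

theorem HasFourier.hasFourier_hat {D : LocalFieldData p c K} {f : TemperedDistr K} {g : K → ℂ}
    (h : D.HasFourier f g) : D.HasFourier f (D.hat f) := by
  rw [hat, dif_pos ⟨g, h⟩]
  exact Exists.choose_spec (p := D.HasFourier f) ⟨g, h⟩

theorem HasFourier.add {D : LocalFieldData p c K} {f f' : TemperedDistr K} {g g' : K → ℂ}
    (h : D.HasFourier f g) (h' : D.HasFourier f' g') : D.HasFourier (f + f') (g + g') := by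
  refine ⟨h.1.add h'.1, fun θ => ?_⟩
  rw [LinearMap.add_apply, h.2, h'.2, ← integral_add (integrable_mul_schwartzBruhat h.1 θ)
    (integrable_mul_schwartzBruhat h'.1 θ)]
  simp only [Pi.add_apply, add_mul]

theorem HasFourier.smul {D : LocalFieldData p c K} {f : TemperedDistr K} {g : K → ℂ}
    (h : D.HasFourier f g) (a : ℂ) : D.HasFourier (a • f) (a • g) := by
  refine ⟨h.1.smul a, fun θ => ?_⟩
  rw [LinearMap.smul_apply, h.2, smul_eq_mul, ← integral_const_mul]
  simp only [Pi.smul_apply, smul_eq_mul, mul_assoc]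

theorem HasFourier.sub {D : LocalFieldData p c K} {f f' : TemperedDistr K} {g g' : K → ℂ}
    (h : D.HasFourier f g) (h' : D.HasFourier f' g') : D.HasFourier (f - f') (g - g') := by
  have := h.add (h'.smul (-1))
  simpa [sub_eq_add_neg] using this

theorem HasFourier.zero (D : LocalFieldData p c K) : D.HasFourier 0 0 :=
  ⟨locallyIntegrable_zero, fun θ => by simp⟩

theorem HasFourier.sum {D : LocalFieldData p c K} {ι : Type*} (S : Finset ι)
    {f : ι → TemperedDistr K} {g : ι → K → ℂ} (h : ∀ i ∈ S, D.HasFourier (f i) (g i)) :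
    D.HasFourier (∑ i ∈ S, f i) (∑ i ∈ S, g i) := by
  induction S using Finset.cons_induction with
  | empty => simpa using HasFourier.zero D
  | cons i S hi ih =>
    rw [Finset.sum_cons, Finset.sum_cons]
    exact (h i (by simp)).add (ih fun j hj => h j (by simp [hj]))

/-- The product of a test function with the character `x ↦ χ(x ξ)`. -/
noncomputable def mulχ (D : LocalFieldData p c K) (ξ : K) (θ : SchwartzBruhat K) :
    SchwartzBruhat K :=
  ⟨fun x => (D.χ (x * ξ) : ℂ) * (θ : K → ℂ) x,
    ((D.isLocallyConstant_χ.comp_continuous (continuous_mul_const ξ)).comp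
      (fun z : Circle => (z : ℂ))).mul θ.2.1, θ.2.2.mul_left⟩

section Ultrametric

variable [IsUltrametricDist K]

/-- The indicator function of a ball as a test function. -/
noncomputable def ballIndicator (K : Type*) [NontriviallyNormedField K] [LocallyCompactSpace K]
    [IsUltrametricDist K] {R : ℝ} (hR : 0 < R) : SchwartzBruhat K :=
  ⟨(Metric.closedBall (0 : K) R).indicator 1,
    ((LocallyConstant.const K (1 : ℂ)).indicator
      (IsUltrametricDist.isClopen_closedBall 0 hR.ne')).isLocallyConstant,
    HasCompactSupport.of_support_subset_isCompact (isCompact_closedBall 0 R)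
      Set.support_indicator_subset⟩

/-- Characters times indicators of balls are test functions, so Fourier uniqueness applies to `g`
cut off to each ball. -/
theorem ae_eq_zero_of_integral_mul_schwartzBruhat (D : LocalFieldData p c K) {g : K → ℂ}
    (hg : LocallyIntegrable g (haarK K))
    (H : ∀ θ : SchwartzBruhat K, ∫ x, g x * (θ : K → ℂ) x ∂(haarK K) = 0) :
    g =ᵐ[haarK K] 0 := by
  have h1 : ∀ n : ℕ, ∀ᵐ x ∂(haarK K),
      g x * (Metric.closedBall (0 : K) (n + 1)).indicator 1 x = 0 := fun n => by
    have hn : (0 : ℝ) < n + 1 := n.cast_add_one_pos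
    refine D.ae_eq_zero_of_integral_mul_χ_eq_zero
      (integrable_mul_schwartzBruhat hg (ballIndicator K hn)) fun ξ => ?_
    rw [← H (D.mulχ ξ (ballIndicator K hn))]
    congr 1
    funext x
    change g x * (Metric.closedBall (0 : K) (n + 1)).indicator 1 x * (D.χ (x * ξ) : ℂ) =
      g x * ((D.χ (x * ξ) : ℂ) * (Metric.closedBall (0 : K) (n + 1)).indicator 1 x)
    ring
  filter_upwards [ae_all_iff.2 h1] with x hx
  obtain ⟨n, hn⟩ := exists_nat_gt ‖x‖
  have := hx n
  rwa [Set.indicator_of_mem (by rw [mem_closedBall_zero_iff]; linarith), Pi.one_apply,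
    mul_one] at this

theorem HasFourier.ae_eq {D : LocalFieldData p c K} {f : TemperedDistr K} {g g' : K → ℂ}
    (h : D.HasFourier f g) (h' : D.HasFourier f g') : g =ᵐ[haarK K] g' := by
  have h1 := h.sub h'
  rw [sub_self] at h1
  have h2 := D.ae_eq_zero_of_integral_mul_schwartzBruhat h1.1 fun θ => by
    rw [← h1.2, LinearMap.zero_apply]
  filter_upwards [h2] with x hx
  exact sub_eq_zero.1 hx

theorem HasFourier.memSobolev_iff {D : LocalFieldData p c K} {f : TemperedDistr K} {g : K → ℂ}
    (h : D.HasFourier f g) (s : ℝ) : D.MemSobolev s f ↔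
      Integrable (fun ξ => (1 + ‖ξ‖ ^ 2) ^ s * ‖g ξ‖ ^ 2) (haarK K) := by
  refine ⟨?_, fun hi => ⟨g, h, hi⟩⟩
  rintro ⟨g', h', hi⟩
  refine hi.congr ?_
  filter_upwards [h.ae_eq h'] with x hx
  rw [hx]

theorem HasFourier.sobolevInner_eq {D : LocalFieldData p c K} {f f' : TemperedDistr K}
    {g g' : K → ℂ} (h : D.HasFourier f g) (h' : D.HasFourier f' g') (s : ℝ) :
    D.sobolevInner s f f' =
      ∫ ξ, (((1 + ‖ξ‖ ^ 2) ^ s : ℝ) : ℂ) * (g ξ * star (g' ξ)) ∂(haarK K) := by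
  refine integral_congr_ae ?_
  filter_upwards [h.ae_eq h.hasFourier_hat, h'.ae_eq h'.hasFourier_hat] with x hx hx'
  rw [hx, hx']

theorem HasFourier.sobolevNorm_eq {D : LocalFieldData p c K} {f : TemperedDistr K}
    {g : K → ℂ} (h : D.HasFourier f g) (s : ℝ) :
    D.sobolevNorm s f = √(∫ ξ, (1 + ‖ξ‖ ^ 2) ^ s * ‖g ξ‖ ^ 2 ∂(haarK K)) := by
  rw [sobolevNorm]
  congr 1
  refine integral_congr_ae ?_
  filter_upwards [h.ae_eq h.hasFourier_hat] with x hx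
  rw [hx]

variable [CharP K p]

theorem card_cast_ne_zero (p c : ℕ) [Fact p.Prime] (R : Type*) [AddMonoidWithOne R] [CharZero R] :
    ((p ^ c : ℕ) : R) ≠ 0 :=
  Nat.cast_ne_zero.2 (pow_ne_zero _ (Fact.out : p.Prime).ne_zero)

theorem norm_zpow_ϖ (D : LocalFieldData p c K) (n : ℤ) :
    ‖(D.ϖ : K) ^ n‖ = ((p ^ c : ℕ) : ℝ) ^ (-n) := by
  rw [norm_zpow, D.norm_ϖ, inv_zpow, zpow_neg]

theorem zpow_ϖ_ne_zero (D : LocalFieldData p c K) (n : ℤ) : (D.ϖ : K) ^ n ≠ 0 :=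
  zpow_ne_zero _ D.ϖ_ne_zero

theorem measurableEmbedding_zpow_ϖ_mul (D : LocalFieldData p c K) (n : ℤ) :
    MeasurableEmbedding fun x : K => (D.ϖ : K) ^ n * x :=
  (Homeomorph.mulLeft₀ _ (D.zpow_ϖ_ne_zero n)).measurableEmbedding

theorem integral_zpow_ϖ_mul {E : Type*} [NormedAddCommGroup E] [NormedSpace ℝ E]
    (D : LocalFieldData p c K) (n : ℤ) (F : K → E) :
    ∫ x, F ((D.ϖ : K) ^ n * x) ∂(haarK K) = ((p ^ c : ℕ) : ℝ) ^ n • ∫ x, F x ∂(haarK K) := by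
  rw [← (D.measurableEmbedding_zpow_ϖ_mul n).integral_map, map_zpow_ϖ_mul_haarK,
    integral_smul_nnreal_measure, NNReal.smul_def]
  push_cast
  rfl

theorem quasiMeasurePreserving_zpow_ϖ_mul (D : LocalFieldData p c K) (n : ℤ) :
    Measure.QuasiMeasurePreserving (fun x : K => (D.ϖ : K) ^ n * x) (haarK K) (haarK K) :=
  ⟨measurable_const_mul _, by
    rw [map_zpow_ϖ_mul_haarK]; exact Measure.smul_absolutelyContinuous⟩

theorem integrable_zpow_ϖ_mul_iff {E : Type*} [NormedAddCommGroup E]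
    (D : LocalFieldData p c K) (n : ℤ) (F : K → E) :
    Integrable (fun x => F ((D.ϖ : K) ^ n * x)) (haarK K) ↔ Integrable F (haarK K) := by
  have h1 := (D.measurableEmbedding_zpow_ϖ_mul n).integrable_map_iff (μ := haarK K) (g := F)
  rw [map_zpow_ϖ_mul_haarK] at h1
  have hq : (((p ^ c : ℕ) : ℝ≥0) ^ n) ≠ 0 := zpow_ne_zero _ (card_cast_ne_zero p c _)
  rw [show (fun x => F ((D.ϖ : K) ^ n * x)) = F ∘ fun x => (D.ϖ : K) ^ n * x from rfl, ← h1]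
  exact integrable_smul_measure (c := ((((p ^ c : ℕ) : ℝ≥0) ^ n : ℝ≥0) : ℝ≥0∞)) (by simpa using hq)
    ENNReal.coe_ne_top

theorem locallyIntegrable_zpow_ϖ_mul {E : Type*} [NormedAddCommGroup E]
    (D : LocalFieldData p c K) (n : ℤ) {F : K → E} (hF : LocallyIntegrable F (haarK K)) :
    LocallyIntegrable (fun x => F ((D.ϖ : K) ^ n * x)) (haarK K) := by
  rw [locallyIntegrable_iff] at hF ⊢
  intro k hk
  have hk' := hk.image (continuous_const_mul ((D.ϖ : K) ^ n))
  have hm := D.measurableEmbedding_zpow_ϖ_mul n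
  have h1 := hF _ hk'
  rw [← integrable_indicator_iff hk.measurableSet]
  rw [← integrable_indicator_iff hk'.measurableSet,
    ← D.integrable_zpow_ϖ_mul_iff n] at h1
  refine h1.congr (Eventually.of_forall fun x => ?_)
  have h2 : (D.ϖ : K) ^ n * x ∈ (fun y => (D.ϖ : K) ^ n * y) '' k ↔ x ∈ k :=
    hm.injective.mem_set_image
  by_cases hx : x ∈ k
  · simp only [Set.indicator_of_mem hx, Set.indicator_of_mem (h2.2 hx)]
  · simp only [Set.indicator_of_notMem hx, Set.indicator_of_notMem (mt h2.1 hx)]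

theorem HasFourier.affine {D : LocalFieldData p c K} {f : TemperedDistr K} {g : K → ℂ}
    (h : D.HasFourier f g) (n : ℤ) (b : K) : D.HasFourier (f.affine (D.ϖ ^ (-n)) b)
      (fun ξ => (((p ^ c : ℕ) : ℝ) ^ (-n) : ℝ) *
        ((D.χ (-(b * ((D.ϖ : K) ^ n * ξ))) : ℂ) * g ((D.ϖ : K) ^ n * ξ))) := by
  have hq : ((p ^ c : ℕ) : ℝ) ≠ 0 := card_cast_ne_zero p c ℝ
  have hχ : Continuous fun ξ => (((p ^ c : ℕ) : ℝ) ^ (-n) : ℝ) *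
      (D.χ (-(b * ((D.ϖ : K) ^ n * ξ))) : ℂ) :=
    continuous_const.mul (D.continuous_χ.comp (by fun_prop))
  refine ⟨?_, fun θ => ?_⟩
  · have := (D.locallyIntegrable_zpow_ϖ_mul n h.1).continuous_smul hχ
    simpa [mul_assoc] using this
  -- The test function for which the affine operation applied to `θ̂` gives `q^n η̂`.
  · let η : SchwartzBruhat K := D.mulχ (-b) (SchwartzBruhat.affine (D.ϖ ^ n) 0 θ)
    have hη : ∀ y, (η : K → ℂ) y = (D.χ (y * -b) : ℂ) * (θ : K → ℂ) ((D.ϖ : K) ^ (-n) * y) :=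
      fun y => by
        simp [η, mulχ, SchwartzBruhat.affine]
    have hF : SchwartzBruhat.affine (D.ϖ ^ (-n)) b (D.fourierTest θ) =
        ((((p ^ c : ℕ) : ℝ) ^ n : ℝ) : ℂ) • D.fourierTest η := by
      ext ξ
      have e1 : (SchwartzBruhat.affine (D.ϖ ^ (-n)) b (D.fourierTest θ) : K → ℂ) ξ =
          (D.fourierTest θ : K → ℂ) ((D.ϖ : K) ^ n * (ξ + b)) := by
        simp [SchwartzBruhat.affine]
      rw [e1, fourierTest_apply]
      rw [Submodule.coe_smul, Pi.smul_apply, fourierTest_apply]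
      have e2 := D.integral_zpow_ϖ_mul (-n)
        (fun x => (D.χ (-(x * ((D.ϖ : K) ^ n * (ξ + b)))) : ℂ) * (θ : K → ℂ) x)
      have e3 : ∀ x, (D.χ (-((D.ϖ : K) ^ (-n) * x * ((D.ϖ : K) ^ n * (ξ + b)))) : ℂ) *
          (θ : K → ℂ) ((D.ϖ : K) ^ (-n) * x) = (D.χ (-(x * ξ)) : ℂ) * (η : K → ℂ) x := fun x => by
        have e6 : -((D.ϖ : K) ^ (-n) * x * ((D.ϖ : K) ^ n * (ξ + b))) = -(x * ξ) + x * -b := by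
          have := D.zpow_ϖ_ne_zero n
          rw [zpow_neg]
          field_simp
          ring
        rw [hη, e6, AddChar.map_add_eq_mul, Circle.coe_mul, mul_assoc]
      simp only [e3] at e2
      rw [e2, smul_eq_mul, Complex.real_smul, ← mul_assoc, ← Complex.ofReal_mul,
        ← zpow_add₀ hq, add_neg_cancel, zpow_zero, Complex.ofReal_one, one_mul]
    have hn : ‖((D.ϖ ^ (-n) : Kˣ) : K)‖⁻¹ = ((p ^ c : ℕ) : ℝ) ^ (-n) := by
      rw [Units.val_zpow_eq_zpow_val, norm_zpow_ϖ, ← zpow_neg, neg_neg]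
    rw [TemperedDistr.affine, LinearMap.smul_apply, LinearMap.comp_apply, hF, map_smul, h.2, hn,
      smul_smul, ← Complex.ofReal_mul, ← zpow_add₀ hq, neg_add_cancel, zpow_zero,
      Complex.ofReal_one, one_smul]
    have e4 := D.integral_zpow_ϖ_mul n (fun y => g y * (η : K → ℂ) y)
    have e5 : ∀ ξ, (((p ^ c : ℕ) : ℝ) ^ (-n) : ℝ) *
        ((D.χ (-(b * ((D.ϖ : K) ^ n * ξ))) : ℂ) * g ((D.ϖ : K) ^ n * ξ)) * (θ : K → ℂ) ξ =
        (((p ^ c : ℕ) : ℝ) ^ (-n) : ℝ) *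
          (g ((D.ϖ : K) ^ n * ξ) * (η : K → ℂ) ((D.ϖ : K) ^ n * ξ)) := fun ξ => by
      rw [hη, zpow_neg (D.ϖ : K), inv_mul_cancel_left₀ (D.zpow_ϖ_ne_zero n), mul_neg, mul_comm b]
      ring
    simp only [e5]
    rw [integral_const_mul, e4, Complex.real_smul, ← mul_assoc, ← Complex.ofReal_mul,
      ← zpow_add₀ hq, neg_add_cancel, zpow_zero, Complex.ofReal_one, one_mul]

theorem HasFourier.dilTrans {D : LocalFieldData p c K} {f : TemperedDistr K} {g : K → ℂ}
    (h : D.HasFourier f g) (ν : ℤ) (k : ℕ) : D.HasFourier (D.dilTrans ν f k)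
      (fun ξ => ((((p ^ c : ℕ) : ℝ) ^ (-(ν : ℝ) / 2) : ℝ) : ℂ) *
        (star (D.χ (D.lam k * ((D.ϖ : K) ^ ν * ξ)) : ℂ) * g ((D.ϖ : K) ^ ν * ξ))) := by
  have h1 := (h.affine ν (D.lam k)).smul ((((p ^ c : ℕ) : ℝ) ^ ((ν : ℝ) / 2) : ℝ) : ℂ)
  refine (congrArg (D.HasFourier _) ?_).mpr h1
  funext ξ
  rw [Pi.smul_apply, smul_eq_mul, ← mul_assoc (Complex.ofReal _) (Complex.ofReal _),
    ← Complex.ofReal_mul, ← Real.rpow_intCast,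
    ← Real.rpow_add (by exact_mod_cast zero_lt_one.trans (one_lt_card p c)),
    AddChar.map_neg_eq_inv, Circle.coe_inv_eq_conj]
  congr 4
  push_cast
  ring

/-- Orthonormality speaks only of the dilates. Undoing the scalar and the dilation shows that `f`
itself has a function as transform, so `hat f` is not the default `0`. -/
theorem exists_hasFourier_of_dilTrans (D : LocalFieldData p c K) {f : TemperedDistr K}
    {g : K → ℂ} {ν : ℤ} (h : D.HasFourier (D.dilTrans ν f 0) g) :
    ∃ g', D.HasFourier f g' := by
  have hc : ((((p ^ c : ℕ) : ℝ) ^ ((ν : ℝ) / 2) : ℝ) : ℂ) ≠ 0 :=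
    Complex.ofReal_ne_zero.2 (Real.rpow_pos_of_pos
      (by exact_mod_cast zero_lt_one.trans (one_lt_card p c)) _).ne'
  have h1 := ((h.smul ((((p ^ c : ℕ) : ℝ) ^ ((ν : ℝ) / 2) : ℝ) : ℂ)⁻¹).affine (-ν) 0)
  rw [LocalFieldData.dilTrans, inv_smul_smul₀ hc, lam_zero, neg_neg, ← inv_zpow', ← inv_inv (D.ϖ ^ ν),
    ← zpow_neg, ← inv_zpow', TemperedDistr.affine_inv_affine] at h1
  exact ⟨_, h1⟩

end Ultrametric

end Distributions

/-! ### Filters as lattice-periodic functions. -/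

section Filters

variable {p c : ℕ} [NeZero c] {K : Type*} [NontriviallyNormedField K] [Fact p.Prime]
  [LocallyCompactSpace K] [MeasurableSpace K] [BorelSpace K]

/-- The normalising factor `q ^ (-1/2)`. -/
noncomputable def invSqrtCard (p c : ℕ) : ℂ := ((((p ^ c : ℕ) : ℝ) ^ (-(1 / 2) : ℝ) : ℝ) : ℂ)

/-- The partial sums of the series which defines the filter with coefficients `a`. -/
noncomputable def filterSum (D : LocalFieldData p c K) (a : ℕ → ℂ) (N : ℕ) : K →ᵇ ℂ :=
  ∑ k ∈ Finset.range N, (invSqrtCard p c * a k) • D.χBdd (-D.lam k)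

theorem star_χ_mul (D : LocalFieldData p c K) (x y : K) :
    star (D.χ (x * y) : ℂ) = D.χBdd (-x) y := by
  rw [χBdd_apply, mul_neg, AddChar.map_neg_eq_inv, Circle.coe_inv_eq_conj, mul_comm]
  rfl

theorem filterSum_apply (D : LocalFieldData p c K) (a : ℕ → ℂ) (N : ℕ) (ξ : K) :
    D.filterSum a N ξ = invSqrtCard p c *
      ∑ k ∈ Finset.range N, a k * star (D.χ (D.lam k * ξ) : ℂ) := by
  rw [filterSum, BoundedContinuousFunction.coe_sum, Finset.sum_apply, Finset.mul_sum]
  refine Finset.sum_congr rfl fun k _ => ?_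
  rw [star_χ_mul, ← mul_assoc]
  rfl

theorem hasFilter_iff (D : LocalFieldData p c K) (a : ℕ → ℂ) (m : K → ℂ) :
    D.HasFilter a m ↔ AEStronglyMeasurable m (haarK K) ∧ ∀ R : ℝ, Tendsto (fun N : ℕ =>
      eLpNorm (fun ξ => m ξ - D.filterSum a N ξ) 2
        ((haarK K).restrict (Metric.closedBall 0 R))) atTop (𝓝 0) := by
  simp only [filterSum_apply]
  rfl

variable [IsUltrametricDist K] [CharP K p]

theorem χBdd_fold (D : LocalFieldData p c K) {l : K} (hl : l ∈ D.lattice) (x : K) :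
    D.χBdd l (D.fold x) = D.χBdd l x := by
  rw [χBdd_apply, χBdd_apply, D.χ_fold_mul hl]

theorem filterSum_fold (D : LocalFieldData p c K) (a : ℕ → ℂ) (N : ℕ) (x : K) :
    D.filterSum a N (D.fold x) = D.filterSum a N x := by
  simp only [filterSum, BoundedContinuousFunction.coe_sum, Finset.sum_apply,
    BoundedContinuousFunction.coe_smul]
  refine Finset.sum_congr rfl fun k _ => ?_
  rw [D.χBdd_fold (D.lattice.neg_mem (D.lam_mem_lattice k))]

theorem integral_χBdd_mul_star (D : LocalFieldData p c K) (n m : ℕ) :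
    ∫ x in Metric.closedBall 0 1, D.χBdd (-D.lam n) x * star (D.χBdd (-D.lam m) x) ∂(haarK K) =
      if n = m then 1 else 0 := by
  have h1 : ∀ x, D.χBdd (-D.lam n) x * star (D.χBdd (-D.lam m) x) =
      (D.χ (x * (D.lam m - D.lam n)) : ℂ) := fun x => by
    have : star (D.χBdd (-D.lam m) x) = D.χBdd (D.lam m) x := by
      rw [← star_χBdd, BoundedContinuousFunction.star_apply, star_star]
    rw [this, ← BoundedContinuousFunction.mul_apply, χBdd_mul, χBdd_apply]
    congr 3
    ring
  simp only [h1, integral_χ_ringOfIntegers]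
  have h2 : ‖D.lam m - D.lam n‖ ≤ 1 ↔ n = m :=
    ⟨fun h => (D.lam_eq_of_norm_sub_le h).symm, fun h => by simp [h]⟩
  simp only [h2]

/-- The characters `ξ ↦ conj χ(λ(k) ξ)` in `L²` of the ring of integers. -/
noncomputable def χLp (D : LocalFieldData p c K) (k : ℕ) :
    Lp ℂ 2 ((haarK K).restrict (Metric.closedBall 0 1)) :=
  BoundedContinuousFunction.toLp 2 _ ℂ (D.χBdd (-D.lam k))

theorem orthonormal_χLp (D : LocalFieldData p c K) : Orthonormal ℂ D.χLp := by
  rw [orthonormal_iff_ite]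
  intro n m
  rw [χLp, χLp, BoundedContinuousFunction.inner_toLp]
  have := D.integral_χBdd_mul_star m n
  simp only [eq_comm (a := m)] at this
  exact this

/-- Riesz–Fischer for the orthonormal characters on the ring of integers. The representative is
measurable outright, so it can be composed with `fold`. -/
theorem exists_tendsto_filterSum (D : LocalFieldData p c K) {a : ℕ → ℂ} (ha : Memℓp a 2) :
    ∃ m : K → ℂ, Measurable m ∧ MemLp m 2 ((haarK K).restrict (Metric.closedBall 0 1)) ∧
      Tendsto (fun N => eLpNorm (fun ξ => m ξ - D.filterSum a N ξ) 2
        ((haarK K).restrict (Metric.closedBall 0 1))) atTop (𝓝 0) := by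
  have h1 : Summable fun k => ‖invSqrtCard p c * a k‖ ^ 2 := by
    have := (memℓp_gen_iff (by norm_num)).1 ha
    simp only [norm_mul, mul_pow]
    refine Summable.mul_left _ ?_
    simpa using this
  have h2 := (D.orthonormal_χLp.orthogonalFamily.summable_iff_norm_sq_summable _).2 h1
  obtain ⟨F, hF⟩ := h2
  refine ⟨F, (Lp.stronglyMeasurable F).measurable, Lp.memLp F, ?_⟩
  have h3 := hF.tendsto_sum_nat
  rw [Lp.tendsto_Lp_iff_tendsto_eLpNorm'] at h3
  refine h3.congr fun N => ?_
  rw [eLpNorm_sub_comm]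
  refine eLpNorm_congr_ae ?_
  have h4 : (∑ k ∈ Finset.range N, (LinearIsometry.toSpanSingleton ℂ _
      (D.orthonormal_χLp.1 k)) (invSqrtCard p c * a k)) =
      BoundedContinuousFunction.toLp 2 ((haarK K).restrict (Metric.closedBall 0 1)) ℂ
        (D.filterSum a N) := by
    rw [filterSum, map_sum]
    refine Finset.sum_congr rfl fun k _ => ?_
    rw [map_smul]
    rfl
  rw [h4]
  filter_upwards [BoundedContinuousFunction.coeFn_toLp 2
    ((haarK K).restrict (Metric.closedBall 0 1)) ℂ (D.filterSum a N)] with x hx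
  rw [Pi.sub_apply, hx]

theorem eLpNorm_comp_fold_le (D : LocalFieldData p c K) {F : K → ℂ}
    (hF : Measurable F) (R : ℝ) :
    eLpNorm (F ∘ D.fold) 2 ((haarK K).restrict (Metric.closedBall 0 R)) ≤
      ((haarK K (Metric.closedBall 0 (max R 1))).toNNReal ^ (1 / 2 : ℝ) : ℝ≥0) *
        eLpNorm F 2 ((haarK K).restrict (Metric.closedBall 0 1)) := by
  set r := (haarK K (Metric.closedBall 0 (max R 1))).toNNReal
  calc _ ≤ eLpNorm (F ∘ D.fold) 2 ((haarK K).restrict (Metric.closedBall 0 (max R 1))) :=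
        eLpNorm_mono_measure _ (Measure.restrict_mono
          (Metric.closedBall_subset_closedBall (le_max_left _ _)) le_rfl)
    _ = eLpNorm F 2 (r • (haarK K).restrict (Metric.closedBall 0 1)) := by
        rw [← D.map_fold_closedBall (le_max_right R 1), eLpNorm_map_measure
          hF.aestronglyMeasurable D.continuous_fold.aemeasurable]
    _ ≤ _ := by
        rw [show r • (haarK K).restrict (Metric.closedBall (0 : K) 1) =
          (r : ℝ≥0∞) • (haarK K).restrict (Metric.closedBall 0 1) from rfl,
          eLpNorm_smul_measure_of_ne_top (by norm_num), smul_eq_mul,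
          ← ENNReal.coe_rpow_of_nonneg _ (by norm_num)]
        simp

/-- The partial sums are lattice-periodic, so convergence on the ring of integers spreads to every
ball for the periodic extension of the limit. -/
theorem hasFilter_comp_fold (D : LocalFieldData p c K) {a : ℕ → ℂ} {m : K → ℂ}
    (hm : Measurable m) (h : Tendsto (fun N => eLpNorm (fun ξ => m ξ - D.filterSum a N ξ) 2
        ((haarK K).restrict (Metric.closedBall 0 1))) atTop (𝓝 0)) :
    D.HasFilter a (m ∘ D.fold) := by
  rw [hasFilter_iff]
  refine ⟨(hm.comp D.continuous_fold.measurable).aestronglyMeasurable, fun R => ?_⟩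
  have hr := fun N => D.eLpNorm_comp_fold_le
    (hm.sub (D.filterSum a N).continuous.measurable) R
  have hcomp : ∀ N, (m - ⇑(D.filterSum a N)) ∘ D.fold =
      fun ξ => (m ∘ D.fold) ξ - D.filterSum a N ξ := fun N => by
    funext ξ
    simp [filterSum_fold]
  simp only [hcomp] at hr
  change ∀ N, _ ≤ _ * eLpNorm (fun ξ => m ξ - D.filterSum a N ξ) _ _ at hr
  refine tendsto_of_tendsto_of_tendsto_of_le_of_le tendsto_const_nhds ?_ (fun _ => zero_le) hr
  simpa using ENNReal.Tendsto.const_mul h (Or.inr ENNReal.coe_ne_top)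

theorem HasFilter.ae_eq {D : LocalFieldData p c K} {a : ℕ → ℂ} {m m' : K → ℂ}
    (h : D.HasFilter a m) (h' : D.HasFilter a m') : m =ᵐ[haarK K] m' := by
  rw [hasFilter_iff] at h h'
  have h1 : ∀ n : ℕ, ∀ᵐ x ∂(haarK K), x ∈ Metric.closedBall (0 : K) n → m x = m' x := fun n => by
    rw [← ae_restrict_iff' Metric.isClosed_closedBall.measurableSet]
    have h2 : eLpNorm (m - m') 2 ((haarK K).restrict (Metric.closedBall 0 n)) = 0 := by
      refine le_antisymm (ge_of_tendsto' (by simpa using (h.2 n).add (h'.2 n)) fun N => ?_)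
        zero_le
      have h3 : m - m' = (fun ξ => m ξ - D.filterSum a N ξ) -
          fun ξ => m' ξ - D.filterSum a N ξ := by
        funext x
        simp
      rw [h3]
      exact eLpNorm_sub_le
        (h.1.restrict.sub (D.filterSum a N).continuous.aestronglyMeasurable)
        (h'.1.restrict.sub (D.filterSum a N).continuous.aestronglyMeasurable) (by norm_num)
    rw [eLpNorm_eq_zero_iff (h.1.sub h'.1).restrict (by norm_num)] at h2
    filter_upwards [h2] with x hx
    exact sub_eq_zero.1 hx
  filter_upwards [ae_all_iff.2 h1] with x hx
  obtain ⟨n, hn⟩ := exists_nat_ge ‖x‖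
  exact hx n (mem_closedBall_zero_iff.2 hn)

theorem HasFilter.hasFilter_filter {D : LocalFieldData p c K} {a : ℕ → ℂ} {m : K → ℂ}
    (h : D.HasFilter a m) : D.HasFilter a (D.filter a) := by
  rw [filter, dif_pos ⟨m, h⟩]
  exact Exists.choose_spec (p := D.HasFilter a) ⟨m, h⟩

end Filters

/-! ### Symbols: the passage between `L²` of the ring of integers and `H^s`. -/

section Symbols

variable {p c : ℕ} [NeZero c] {K : Type*} [NontriviallyNormedField K] [Fact p.Prime]
  [LocallyCompactSpace K] [MeasurableSpace K] [BorelSpace K]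

/-- The density `(1 + |ϖ ^ (-n) η|²) ^ s |Φ(η)|²`. -/
noncomputable def density (D : LocalFieldData p c K) (s : ℝ) (n : ℤ) (Φ : K → ℂ) (η : K) : ℝ≥0 :=
  ((1 + ‖(D.ϖ : K) ^ (-n) * η‖ ^ 2) ^ s * ‖Φ η‖ ^ 2).toNNReal

/-- The measure which describes the inner product of `H^s` on distributions with Fourier transform
`q ^ (-n/2) G(ϖ ^ n ·) Φ(ϖ ^ n ·)`. -/
noncomputable def spectralMeasure (D : LocalFieldData p c K) (s : ℝ) (n : ℤ) (Φ : K → ℂ) :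
    Measure K :=
  (haarK K).withDensity fun η => (D.density s n Φ η : ℝ≥0∞)

/-- The function `q ^ (-n/2) G(ϖ ^ n ·) Φ(ϖ ^ n ·)`. -/
noncomputable def symbolHat (D : LocalFieldData p c K) (n : ℤ) (Φ G : K → ℂ) (ξ : K) : ℂ :=
  ((((p ^ c : ℕ) : ℝ) ^ (-(n : ℝ) / 2) : ℝ) : ℂ) *
    (G ((D.ϖ : K) ^ n * ξ) * Φ ((D.ϖ : K) ^ n * ξ))

theorem weight_pos (s : ℝ) (x : K) : 0 < (1 + ‖x‖ ^ 2) ^ s :=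
  Real.rpow_pos_of_pos (by positivity) _

theorem continuous_weight (s : ℝ) : Continuous fun x : K => (1 + ‖x‖ ^ 2) ^ s :=
  (by fun_prop : Continuous fun x : K => 1 + ‖x‖ ^ 2).rpow_const
    fun x => Or.inl (by positivity)

theorem coe_density (D : LocalFieldData p c K) (s : ℝ) (n : ℤ) (Φ : K → ℂ) (η : K) :
    (D.density s n Φ η : ℝ) = (1 + ‖(D.ϖ : K) ^ (-n) * η‖ ^ 2) ^ s * ‖Φ η‖ ^ 2 :=
  Real.coe_toNNReal _ (mul_nonneg (weight_pos s _).le (sq_nonneg _))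

theorem aemeasurable_density (D : LocalFieldData p c K) (s : ℝ) (n : ℤ) {Φ : K → ℂ}
    (hΦ : AEStronglyMeasurable Φ (haarK K)) : AEMeasurable (D.density s n Φ) (haarK K) :=
  ((((continuous_weight s).comp
    (continuous_const_mul ((D.ϖ : K) ^ (-n)))).measurable.aemeasurable).mul
    (hΦ.norm.aemeasurable.pow_const 2)).real_toNNReal

theorem rpow_neg_half_sq (p c : ℕ) [Fact p.Prime] (n : ℤ) :
    (((p ^ c : ℕ) : ℝ) ^ (-(n : ℝ) / 2)) ^ 2 * ((p ^ c : ℕ) : ℝ) ^ n = 1 := by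
  have hq : (0 : ℝ) < ((p ^ c : ℕ) : ℝ) := by
    exact_mod_cast pow_pos (Fact.out : p.Prime).pos c
  rw [← Real.rpow_natCast, ← Real.rpow_mul hq.le, ← Real.rpow_intCast, ← Real.rpow_add hq]
  norm_num

theorem norm_sq_symbolHat (D : LocalFieldData p c K) (s : ℝ) (n : ℤ) (Φ G : K → ℂ) (ξ : K) :
    (1 + ‖ξ‖ ^ 2) ^ s * ‖D.symbolHat n Φ G ξ‖ ^ 2 =
      (((p ^ c : ℕ) : ℝ) ^ (-(n : ℝ) / 2)) ^ 2 *
        (D.density s n Φ ((D.ϖ : K) ^ n * ξ) • ‖G ((D.ϖ : K) ^ n * ξ)‖ ^ 2) := by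
  have hz : (D.ϖ : K) ^ n ≠ 0 := zpow_ne_zero _ D.ϖ_ne_zero
  have hq : (0 : ℝ) ≤ ((p ^ c : ℕ) : ℝ) ^ (-(n : ℝ) / 2) := by positivity
  rw [symbolHat, NNReal.smul_def, coe_density, zpow_neg, inv_mul_cancel_left₀ hz, norm_mul,
    norm_mul, Complex.norm_real, Real.norm_of_nonneg hq, smul_eq_mul]
  ring

theorem mul_star_symbolHat (D : LocalFieldData p c K) (s : ℝ) (n : ℤ) (Φ G G' : K → ℂ) (ξ : K) :
    (((1 + ‖ξ‖ ^ 2) ^ s : ℝ) : ℂ) * (D.symbolHat n Φ G ξ * star (D.symbolHat n Φ G' ξ)) =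
      (((((p ^ c : ℕ) : ℝ) ^ (-(n : ℝ) / 2)) ^ 2 : ℝ) : ℂ) *
        (D.density s n Φ ((D.ϖ : K) ^ n * ξ) •
          (G ((D.ϖ : K) ^ n * ξ) * star (G' ((D.ϖ : K) ^ n * ξ)))) := by
  have hz : (D.ϖ : K) ^ n ≠ 0 := zpow_ne_zero _ D.ϖ_ne_zero
  have h1 : ((‖Φ ((D.ϖ : K) ^ n * ξ)‖ ^ 2 : ℝ) : ℂ) =
      Φ ((D.ϖ : K) ^ n * ξ) * star (Φ ((D.ϖ : K) ^ n * ξ)) := by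
    rw [Complex.star_def, Complex.mul_conj, Complex.normSq_eq_norm_sq]
  rw [symbolHat, symbolHat, NNReal.smul_def, coe_density, zpow_neg, inv_mul_cancel_left₀ hz,
    Complex.real_smul, Complex.ofReal_mul, h1, star_mul', star_mul', Complex.star_def,
    Complex.conj_ofReal, Complex.ofReal_pow]
  ring

variable [IsUltrametricDist K] [CharP K p]

/-- The substitution `η = ϖ^n ξ` contributes a factor `q^n`, cancelled by the square of `q^(-n/2)`;
the weight keeps its dependence on `n`. -/
theorem integral_norm_sq_symbolHat (D : LocalFieldData p c K) (s : ℝ) (n : ℤ) {Φ : K → ℂ}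
    (hΦ : AEStronglyMeasurable Φ (haarK K)) (G : K → ℂ) :
    ∫ ξ, (1 + ‖ξ‖ ^ 2) ^ s * ‖D.symbolHat n Φ G ξ‖ ^ 2 ∂(haarK K) =
      ∫ η, ‖G η‖ ^ 2 ∂(D.spectralMeasure s n Φ) := by
  rw [spectralMeasure, integral_withDensity_eq_integral_smul₀ (D.aemeasurable_density s n hΦ)]
  simp only [norm_sq_symbolHat]
  rw [integral_const_mul, D.integral_zpow_ϖ_mul n fun η => D.density s n Φ η • ‖G η‖ ^ 2,
    smul_eq_mul, ← mul_assoc, rpow_neg_half_sq, one_mul]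

theorem integral_mul_star_symbolHat (D : LocalFieldData p c K) (s : ℝ) (n : ℤ) {Φ : K → ℂ}
    (hΦ : AEStronglyMeasurable Φ (haarK K)) (G G' : K → ℂ) :
    ∫ ξ, (((1 + ‖ξ‖ ^ 2) ^ s : ℝ) : ℂ) *
        (D.symbolHat n Φ G ξ * star (D.symbolHat n Φ G' ξ)) ∂(haarK K) =
      ∫ η, G η * star (G' η) ∂(D.spectralMeasure s n Φ) := by
  rw [spectralMeasure, integral_withDensity_eq_integral_smul₀ (D.aemeasurable_density s n hΦ)]
  simp only [mul_star_symbolHat]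
  rw [integral_const_mul,
    D.integral_zpow_ϖ_mul n fun η => D.density s n Φ η • (G η * star (G' η)),
    Complex.real_smul, ← mul_assoc, ← Complex.ofReal_mul, rpow_neg_half_sq, Complex.ofReal_one,
    one_mul]

theorem integrable_norm_sq_symbolHat_iff (D : LocalFieldData p c K) (s : ℝ) (n : ℤ) {Φ : K → ℂ}
    (hΦ : AEStronglyMeasurable Φ (haarK K)) (G : K → ℂ) :
    Integrable (fun ξ => (1 + ‖ξ‖ ^ 2) ^ s * ‖D.symbolHat n Φ G ξ‖ ^ 2) (haarK K) ↔
      Integrable (fun η => ‖G η‖ ^ 2) (D.spectralMeasure s n Φ) := by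
  rw [spectralMeasure,
    integrable_withDensity_iff_integrable_smul₀ (D.aemeasurable_density s n hΦ),
    ← D.integrable_zpow_ϖ_mul_iff n fun η => D.density s n Φ η • ‖G η‖ ^ 2]
  simp only [norm_sq_symbolHat]
  have hu : IsUnit ((((p ^ c : ℕ) : ℝ) ^ (-(n : ℝ) / 2)) ^ 2) :=
    IsUnit.of_mul_eq_one _ (rpow_neg_half_sq p c n)
  exact integrable_const_mul_iff hu _

/-- `f` has the Fourier transform `q ^ (-n/2) G(ϖ ^ n ·) Φ(ϖ ^ n ·)` with the lattice-periodic
extension of `G`. -/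
def HasSymbol (D : LocalFieldData p c K) (n : ℤ) (Φ : K → ℂ) (f : TemperedDistr K) (G : K → ℂ) :
    Prop :=
  D.HasFourier f (D.symbolHat n Φ (G ∘ D.fold))

theorem HasSymbol.sub {D : LocalFieldData p c K} {n : ℤ} {Φ : K → ℂ} {f f' : TemperedDistr K}
    {G G' : K → ℂ} (h : D.HasSymbol n Φ f G) (h' : D.HasSymbol n Φ f' G') :
    D.HasSymbol n Φ (f - f') (G - G') := by
  have := HasFourier.sub h h'
  refine (congrArg (D.HasFourier _) ?_).mpr this
  funext ξ
  simp only [symbolHat, Function.comp_apply, Pi.sub_apply]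
  ring

theorem HasSymbol.sum_smul {D : LocalFieldData p c K} {n : ℤ} {Φ : K → ℂ} {ι : Type*}
    (S : Finset ι) (a : ι → ℂ) {f : ι → TemperedDistr K} {G : ι → K → ℂ}
    (h : ∀ i ∈ S, D.HasSymbol n Φ (f i) (G i)) :
    D.HasSymbol n Φ (∑ i ∈ S, a i • f i) (fun x => ∑ i ∈ S, a i * G i x) := by
  have := HasFourier.sum S fun i hi => HasFourier.smul (h i hi) (a i)
  refine (congrArg (D.HasFourier _) ?_).mpr this
  funext ξ
  simp only [symbolHat, Function.comp_apply, Finset.sum_apply, Pi.smul_apply, smul_eq_mul,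
    Finset.sum_mul, Finset.mul_sum]
  exact Finset.sum_congr rfl fun i _ => by ring

section Periodized

variable {D : LocalFieldData p c K} {s : ℝ} {n : ℤ} {Φ : K → ℂ}

/-- The integrand factors through `fold`, so only the folded spectral measure matters. This is the
isometry on which the theorem rests. -/
theorem HasSymbol.sobolevInner_eq (hΦ : AEStronglyMeasurable Φ (haarK K))
    (hμ : (D.spectralMeasure s n Φ).map D.fold = (haarK K).restrict (Metric.closedBall 0 1))
    {f f' : TemperedDistr K} {G G' : K → ℂ} (h : D.HasSymbol n Φ f G) (h' : D.HasSymbol n Φ f' G')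
    (hG : Measurable G) (hG' : Measurable G') :
    D.sobolevInner s f f' = ∫ η in Metric.closedBall 0 1, G η * star (G' η) ∂(haarK K) := by
  rw [HasFourier.sobolevInner_eq h h', D.integral_mul_star_symbolHat s n hΦ, ← hμ,
    integral_map D.continuous_fold.aemeasurable]
  · rfl
  · exact (hG.mul (Complex.continuous_conj.measurable.comp hG')).aestronglyMeasurable

theorem HasSymbol.memSobolev (hΦ : AEStronglyMeasurable Φ (haarK K))
    (hμ : (D.spectralMeasure s n Φ).map D.fold = (haarK K).restrict (Metric.closedBall 0 1))
    {f : TemperedDistr K} {G : K → ℂ} (h : D.HasSymbol n Φ f G) (hG : Measurable G)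
    (hi : MemLp G 2 ((haarK K).restrict (Metric.closedBall 0 1))) : D.MemSobolev s f := by
  rw [HasFourier.memSobolev_iff h, D.integrable_norm_sq_symbolHat_iff s n hΦ]
  have h1 := hi.integrable_norm_pow (by norm_num)
  rw [← hμ, integrable_map_measure (hG.norm.pow_const _).aestronglyMeasurable
    D.continuous_fold.aemeasurable] at h1
  exact h1

theorem HasSymbol.sobolevNorm_eq (hΦ : AEStronglyMeasurable Φ (haarK K))
    (hμ : (D.spectralMeasure s n Φ).map D.fold = (haarK K).restrict (Metric.closedBall 0 1))
    {f : TemperedDistr K} {G : K → ℂ} (h : D.HasSymbol n Φ f G) (hG : Measurable G)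
    (hi : MemLp G 2 ((haarK K).restrict (Metric.closedBall 0 1))) :
    D.sobolevNorm s f =
      (eLpNorm G 2 ((haarK K).restrict (Metric.closedBall 0 1))).toReal := by
  rw [HasFourier.sobolevNorm_eq h, D.integral_norm_sq_symbolHat s n hΦ,
    hi.eLpNorm_eq_integral_rpow_norm (by norm_num) (by norm_num), ENNReal.toReal_ofReal
    (by positivity), Real.sqrt_eq_rpow, ← hμ, integral_map D.continuous_fold.aemeasurable]
  · norm_num
  · exact (hG.norm.pow_const _).aestronglyMeasurable

end Periodized

theorem HasFourier.hasSymbol_dilTrans {D : LocalFieldData p c K} {f : TemperedDistr K} {Φ : K → ℂ}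
    (h : D.HasFourier f Φ) (n : ℤ) (k : ℕ) :
    D.HasSymbol n Φ (D.dilTrans n f k) (D.χBdd (-D.lam k)) := by
  refine (congrArg (D.HasFourier _) ?_).mpr (h.dilTrans n k)
  funext ξ
  rw [symbolHat, Function.comp_apply, D.χBdd_fold (D.lattice.neg_mem (D.lam_mem_lattice k)),
    star_χ_mul]

/-- The periodization of the density of an orthonormal system of translates is constant. -/
theorem map_fold_spectralMeasure {D : LocalFieldData p c K} {s : ℝ} {n : ℤ} {f : TemperedDistr K}
    {Φ : K → ℂ} (h : D.HasFourier f Φ) (hf : D.OrthonormalSystem s fun k : ℕ => D.dilTrans n f k) :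
    (D.spectralMeasure s n Φ).map D.fold = (haarK K).restrict (Metric.closedBall 0 1) := by
  have hΦ : AEStronglyMeasurable Φ (haarK K) := h.1.aestronglyMeasurable
  have hint := (HasFourier.memSobolev_iff (h.hasSymbol_dilTrans n 0) s).1 (hf.1 0)
  rw [D.integrable_norm_sq_symbolHat_iff s n hΦ] at hint
  have hone : ∀ x, D.χBdd (-D.lam 0) x = 1 := fun x => by
    simp [χBdd_apply, lam_zero]
  have hfin : IsFiniteMeasure (D.spectralMeasure s n Φ) := by
    simp only [Function.comp_apply, hone, norm_one, one_pow] at hint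
    simpa [integrable_const_iff] using hint
  -- The inner products of the zeroth element with the others are the Fourier coefficients of the
  -- spectral measure.
  have := D.map_fold (μ := D.spectralMeasure s n Φ) (r := 1) fun k => by
    have h1 := hf.2 0 k
    rw [HasFourier.sobolevInner_eq (h.hasSymbol_dilTrans n 0) (h.hasSymbol_dilTrans n k),
      D.integral_mul_star_symbolHat s n hΦ] at h1
    simp only [Function.comp_apply, hone, one_mul,
      D.χBdd_fold (D.lattice.neg_mem (D.lam_mem_lattice k)), ← star_χ_mul, star_star] at h1
    simp only [mul_comm (D.lam k)] at h1
    rw [h1]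
    simp [eq_comm]
  rwa [one_smul] at this

theorem density_integrable {D : LocalFieldData p c K} {s : ℝ} {n : ℤ} {Φ : K → ℂ}
    (hΦ : AEStronglyMeasurable Φ (haarK K)) (h : IsFiniteMeasure (D.spectralMeasure s n Φ)) :
    Integrable (fun η => (D.density s n Φ η : ℝ)) (haarK K) := by
  have h1 : Integrable (fun _ => (1 : ℝ)) (D.spectralMeasure s n Φ) := integrable_const 1
  rw [spectralMeasure,
    integrable_withDensity_iff_integrable_smul₀ (D.aemeasurable_density s n hΦ)] at h1
  simpa [NNReal.smul_def] using h1

/-- On a ball the inverse of the weight is bounded, so `Φ` is square integrable there; so is the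
periodic extension of `G`, and the product is integrable. -/
theorem locallyIntegrable_symbol_mul {D : LocalFieldData p c K} {s : ℝ} {n : ℤ} {Φ : K → ℂ}
    (hΦ : AEStronglyMeasurable Φ (haarK K))
    (hμ : (D.spectralMeasure s n Φ).map D.fold = (haarK K).restrict (Metric.closedBall 0 1))
    {G : K → ℂ} (hG : Measurable G)
    (hi : MemLp G 2 ((haarK K).restrict (Metric.closedBall 0 1))) :
    LocallyIntegrable (fun η => G (D.fold η) * Φ η) (haarK K) := by
  have hfin : IsFiniteMeasure (D.spectralMeasure s n Φ) := by
    refine ⟨?_⟩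
    have := congrArg (fun m => m Set.univ) hμ
    simp only [Measure.map_apply D.continuous_fold.measurable MeasurableSet.univ,
      Set.preimage_univ] at this
    rw [this]
    exact measure_lt_top _ _
  have hd := density_integrable hΦ hfin
  rw [locallyIntegrable_iff]
  intro k hk
  obtain ⟨R, hR⟩ := hk.isBounded.subset_closedBall (0 : K)
  refine IntegrableOn.mono_set ?_ hR
  have h1 : IntegrableOn (fun η => ‖Φ η‖ ^ 2) (Metric.closedBall 0 R) (haarK K) := by
    have hc : ContinuousOn (fun η : K => ((1 + ‖(D.ϖ : K) ^ (-n) * η‖ ^ 2) ^ s)⁻¹)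
        (Metric.closedBall 0 R) :=
      (((continuous_weight s).comp (continuous_const_mul ((D.ϖ : K) ^ (-n)))).inv₀
        fun x => (weight_pos s _).ne').continuousOn
    refine (hd.integrableOn.mul_continuousOn hc (isCompact_closedBall 0 R)).congr_fun (fun η _ => ?_)
      Metric.isClosed_closedBall.measurableSet
    simp only [coe_density]
    field_simp [(weight_pos s ((D.ϖ : K) ^ (-n) * η)).ne']
  have h2 : IntegrableOn (fun η => ‖G (D.fold η)‖ ^ 2) (Metric.closedBall 0 R) (haarK K) := by
    have hL : MemLp (G ∘ D.fold) 2 ((haarK K).restrict (Metric.closedBall 0 R)) :=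
      ⟨(hG.comp D.continuous_fold.measurable).aestronglyMeasurable,
        (D.eLpNorm_comp_fold_le hG R).trans_lt (ENNReal.mul_lt_top ENNReal.coe_lt_top hi.2)⟩
    exact hL.integrable_norm_pow (by norm_num)
  refine (h2.add h1).mono' ((hG.comp D.continuous_fold.measurable).aestronglyMeasurable.mul
    hΦ.restrict) (Eventually.of_forall fun η => ?_)
  simp only [norm_mul, Pi.add_apply]
  nlinarith [sq_nonneg (‖G (D.fold η)‖ - ‖Φ η‖), sq_nonneg ‖G (D.fold η)‖, sq_nonneg ‖Φ η‖]

end Symbols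

/-! ### Symbols and correlations of the wavelets. -/

section Wavelets

variable {p c : ℕ} [NeZero c] {K : Type*} [NontriviallyNormedField K] [Fact p.Prime]
  [LocallyCompactSpace K] [MeasurableSpace K] [BorelSpace K]

theorem HasFourier.congr {D : LocalFieldData p c K} {f : TemperedDistr K} {g g' : K → ℂ}
    (h : D.HasFourier f g) (hg : g =ᵐ[haarK K] g') : D.HasFourier f g' := by
  refine ⟨fun x => ?_, fun θ => ?_⟩
  · obtain ⟨U, hU, hi⟩ := h.1 x
    exact ⟨U, hU, hi.congr (ae_restrict_of_ae hg)⟩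
  · rw [h.2]
    refine integral_congr_ae ?_
    filter_upwards [hg] with x hx
    rw [hx]

variable [IsUltrametricDist K] [CharP K p]

theorem integrableOn_comp_ϖ_mul_add {D : LocalFieldData p c K} {F : K → ℂ}
    (hF : IntegrableOn F (Metric.closedBall 0 1) (haarK K)) {r : ℕ} (hr : r < p ^ c) :
    IntegrableOn (fun x => F ((D.ϖ : K) * x + (D.ϖ : K) * D.lam r)) (Metric.closedBall 0 1)
      (haarK K) := by
  rw [← integrable_indicator_iff Metric.isClosed_closedBall.measurableSet,
    ← D.integrable_zpow_ϖ_mul_iff 1] at hF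
  have h1 := (hF.comp_add_right (D.lam r)).integrableOn (s := Metric.closedBall 0 1)
  refine h1.congr_fun (fun x hx => ?_) Metric.isClosed_closedBall.measurableSet
  have hmem : (D.ϖ : K) * x + (D.ϖ : K) * D.lam r ∈ Metric.closedBall (0 : K) 1 := by
    have : (D.ϖ : K) * (D.lam r + x) ∈ Metric.closedBall (0 : K) 1 := by
      have h2 : D.lam r + x ∈ {x : K | ‖(D.ϖ : K) * x‖ ≤ 1} := by
        rw [D.setOf_norm_ϖ_mul_le]
        exact Set.mem_iUnion.2 ⟨⟨r, hr⟩, x, hx, rfl⟩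
      exact mem_closedBall_zero_iff.2 h2
    rwa [mul_add, add_comm] at this
  simp only [zpow_one, mul_add, Set.indicator_of_mem hmem]

/-- Dilation by `ϖ` replaces the ring of integers by `ϖ⁻¹𝒟` and produces the factor `q`; then `ϖ⁻¹𝒟`
splits into the translates `λ(r) + 𝒟`. -/
theorem integral_ringOfIntegers_decompose {D : LocalFieldData p c K} {F : K → ℂ}
    (hF : IntegrableOn F (Metric.closedBall 0 1) (haarK K)) :
    ((p ^ c : ℕ) : ℂ) * ∫ x in Metric.closedBall 0 1, F x ∂(haarK K) =
      ∫ x in Metric.closedBall 0 1,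
        ∑ r : Fin (p ^ c), F ((D.ϖ : K) * x + (D.ϖ : K) * D.lam r) ∂(haarK K) := by
  have hms : MeasurableSet (Metric.closedBall (0 : K) 1) := Metric.isClosed_closedBall.measurableSet
  rw [integral_finsetSum _ fun r _ => integrableOn_comp_ϖ_mul_add hF r.2]
  set E : K → ℂ := fun x => (Metric.closedBall 0 1).indicator F ((D.ϖ : K) * x) with hE
  have hEi : Integrable E (haarK K) := by
    rw [← integrable_indicator_iff hms, ← D.integrable_zpow_ϖ_mul_iff 1] at hF
    simpa using hF
  have h1 : ∫ x, E x ∂(haarK K) =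
      ((p ^ c : ℕ) : ℂ) * ∫ x in Metric.closedBall 0 1, F x ∂(haarK K) := by
    have := D.integral_zpow_ϖ_mul 1 ((Metric.closedBall (0 : K) 1).indicator F)
    rw [integral_indicator hms] at this
    simpa using this
  have himg : ∀ k : Fin (p ^ c), MeasurableSet ((fun x => D.lam k + x) '' Metric.closedBall (0 : K) 1) :=
    fun k => by
      rw [Set.image_add_left]
      exact measurable_const_add _ hms
  rw [← h1, ← setIntegral_eq_integral_of_forall_compl_eq_zero (s := {x : K | ‖(D.ϖ : K) * x‖ ≤ 1}),
    D.setOf_norm_ϖ_mul_le, integral_iUnion_fintype (fun k => himg k)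
      (fun k k' hkk => D.pairwise_disjoint_lam_add (Fin.val_ne_of_ne hkk))
      (fun k => hEi.integrableOn)]
  · refine Finset.sum_congr rfl fun r _ => ?_
    rw [(measurePreserving_add_left (haarK K) (D.lam r)).setIntegral_image_emb
      (measurableEmbedding_addLeft (D.lam r))]
    refine setIntegral_congr_fun hms fun x hx => ?_
    have hmem : (D.ϖ : K) * (D.lam r + x) ∈ Metric.closedBall (0 : K) 1 := by
      have h2 : D.lam r + x ∈ {x : K | ‖(D.ϖ : K) * x‖ ≤ 1} := by
        rw [D.setOf_norm_ϖ_mul_le]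
        exact Set.mem_iUnion.2 ⟨r, x, hx, rfl⟩
      exact mem_closedBall_zero_iff.2 h2
    simp only [hE, Set.indicator_of_mem hmem]
    rw [mul_add, add_comm]
  · intro x hx
    exact Set.indicator_of_notMem (fun h => hx (mem_closedBall_zero_iff.1 h)) _

theorem invSqrtCard_ne_zero (p c : ℕ) [Fact p.Prime] : invSqrtCard p c ≠ 0 :=
  Complex.ofReal_ne_zero.2 (Real.rpow_pos_of_pos
    (by exact_mod_cast pow_pos (Fact.out : p.Prime).pos c) _).ne'

theorem invSqrtCard_inv_mul_star (p c : ℕ) [Fact p.Prime] :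
    (invSqrtCard p c)⁻¹ * star (invSqrtCard p c)⁻¹ = ((p ^ c : ℕ) : ℂ) := by
  have hq : (0 : ℝ) < ((p ^ c : ℕ) : ℝ) := by
    exact_mod_cast pow_pos (Fact.out : p.Prime).pos c
  rw [star_inv₀, Complex.star_def, invSqrtCard, Complex.conj_ofReal, ← mul_inv,
    ← Complex.ofReal_mul, ← Real.rpow_add hq, ← Complex.ofReal_inv, ← Real.rpow_neg hq.le]
  norm_num

/-- The symbol of the `k`-th translate of the wavelet with filter `m`. -/
noncomputable def waveletSymbol (D : LocalFieldData p c K) (m : K → ℂ) (k : ℕ) (η : K) : ℂ :=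
  (invSqrtCard p c)⁻¹ * (D.χBdd (-D.lam (p ^ c * k)) η * m η)

theorem measurable_waveletSymbol (D : LocalFieldData p c K) {m : K → ℂ} (hm : Measurable m)
    (k : ℕ) : Measurable (D.waveletSymbol m k) :=
  measurable_const.mul ((D.χBdd _).continuous.measurable.mul hm)

theorem norm_χBdd (D : LocalFieldData p c K) (ξ x : K) : ‖D.χBdd ξ x‖ = 1 := Circle.norm_coe _

theorem eLpNorm_waveletSymbol (D : LocalFieldData p c K) (m : K → ℂ) (k : ℕ) (μ : Measure K) :
    eLpNorm (D.waveletSymbol m k) 2 μ = ‖(invSqrtCard p c)⁻¹‖ₑ * eLpNorm m 2 μ := by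
  have h1 : D.waveletSymbol m k =
      (invSqrtCard p c)⁻¹ • fun η => D.χBdd (-D.lam (p ^ c * k)) η * m η := rfl
  rw [h1, eLpNorm_const_smul]
  congr 1
  refine eLpNorm_congr_norm_ae (Eventually.of_forall fun x => ?_)
  rw [norm_mul, norm_χBdd, one_mul]

theorem memLp_waveletSymbol (D : LocalFieldData p c K) {m : K → ℂ} (hm : Measurable m)
    {μ : Measure K} (hi : MemLp m 2 μ) (k : ℕ) : MemLp (D.waveletSymbol m k) 2 μ :=
  ⟨(D.measurable_waveletSymbol hm k).aestronglyMeasurable, by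
    rw [eLpNorm_waveletSymbol]
    exact ENNReal.mul_lt_top enorm_lt_top hi.2⟩

/-- The wavelet at level `ν` is read at level `ν + 1`, where the spectral measure is known. The
frequency becomes `ϖ⁻¹ λ(k) = λ(qk)`, and `q^(1/2)` compensates the change of normalisation. -/
theorem HasFourier.hasSymbol_dilTrans_wavelet {D : LocalFieldData p c K} {ψ : TemperedDistr K}
    {Φ m : K → ℂ} (h : D.HasFourier ψ fun ξ => m (D.fold ((D.ϖ : K) * ξ)) * Φ ((D.ϖ : K) * ξ))
    (ν : ℤ) (k : ℕ) : D.HasSymbol (ν + 1) Φ (D.dilTrans ν ψ k) (D.waveletSymbol m k) := by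
  refine (congrArg (D.HasFourier _) ?_).mpr (h.dilTrans ν k)
  funext ξ
  have hq : (0 : ℝ) < ((p ^ c : ℕ) : ℝ) := by
    exact_mod_cast pow_pos (Fact.out : p.Prime).pos c
  have e1 : (D.ϖ : K) ^ (ν + 1) * ξ = (D.ϖ : K) * ((D.ϖ : K) ^ ν * ξ) := by
    rw [zpow_add_one₀ D.ϖ_ne_zero]; ring
  have e2 : ((((p ^ c : ℕ) : ℝ) ^ (-((ν + 1 : ℤ) : ℝ) / 2) : ℝ) : ℂ) =
      ((((p ^ c : ℕ) : ℝ) ^ (-(ν : ℝ) / 2) : ℝ) : ℂ) * invSqrtCard p c := by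
    rw [invSqrtCard, ← Complex.ofReal_mul, ← Real.rpow_add hq]
    congr 2
    push_cast
    ring
  have e3 : D.χBdd (-D.lam (p ^ c * k)) ((D.ϖ : K) * ((D.ϖ : K) ^ ν * ξ)) =
      D.χBdd (-D.lam k) ((D.ϖ : K) ^ ν * ξ) := by
    rw [χBdd_apply, χBdd_apply, ← inv_ϖ_mul_lam]
    congr 2
    have := D.ϖ_ne_zero
    field_simp
  rw [symbolHat, Function.comp_apply, waveletSymbol,
    D.χBdd_fold (D.lattice.neg_mem (D.lam_mem_lattice _)), e1, e2, e3, star_χ_mul]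
  have := invSqrtCard_ne_zero p c
  field_simp

theorem hasSymbol_mem_closedSpan {D : LocalFieldData p c K} {s : ℝ} {n : ℤ} {Φ : K → ℂ}
    (hΦ : AEStronglyMeasurable Φ (haarK K))
    (hμ : (D.spectralMeasure s n Φ).map D.fold = (haarK K).restrict (Metric.closedBall 0 1))
    {u : ℕ → TemperedDistr K} (hu : ∀ k, D.HasSymbol n Φ (u k) (D.χBdd (-D.lam k)))
    {a : ℕ → ℂ} {m : K → ℂ} (hm : Measurable m)
    (hi : MemLp m 2 ((haarK K).restrict (Metric.closedBall 0 1)))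
    (hlim : Tendsto (fun N => eLpNorm (fun ξ => m ξ - D.filterSum a N ξ) 2
        ((haarK K).restrict (Metric.closedBall 0 1))) atTop (𝓝 0))
    {f : TemperedDistr K} {k : ℕ} (hf : D.HasSymbol n Φ f (D.waveletSymbol m k)) :
    f ∈ D.closedSpan s u := by
  refine ⟨hf.memSobolev hΦ hμ (D.measurable_waveletSymbol hm k) (D.memLp_waveletSymbol hm hi k),
    fun ε hε => ?_⟩
  -- Multiplying the filter series by the character of `λ(qk)` shifts its frequencies to `λ(qk) +
  -- λ(i)`, again lattice points; this names their indices.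
  choose t ht using fun i => D.exists_lam_add (p ^ c * k) i
  have hsum : ∀ N, D.HasSymbol n Φ (∑ i ∈ Finset.range N, a i • u (t i))
      (D.waveletSymbol (D.filterSum a N) k) := fun N => by
    refine (congrArg (D.HasSymbol n Φ _) ?_).mpr
      (HasSymbol.sum_smul (Finset.range N) a fun i _ => hu (t i))
    funext η
    rw [waveletSymbol, filterSum_apply, Finset.mul_sum, Finset.mul_sum, Finset.mul_sum]
    refine Finset.sum_congr rfl fun i _ => ?_
    rw [ht, neg_add, ← χBdd_mul, BoundedContinuousFunction.mul_apply, star_χ_mul]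
    have := invSqrtCard_ne_zero p c
    field_simp
  have hmN : ∀ N, Measurable fun ξ => m ξ - D.filterSum a N ξ := fun N =>
    hm.sub (D.filterSum a N).continuous.measurable
  have hiN : ∀ N, MemLp (fun ξ => m ξ - D.filterSum a N ξ) 2
      ((haarK K).restrict (Metric.closedBall 0 1)) := fun N =>
    hi.sub ((D.filterSum a N).memLp_top.mono_exponent le_top)
  have hdiff : ∀ N, D.HasSymbol n Φ (f - ∑ i ∈ Finset.range N, a i • u (t i))
      (D.waveletSymbol (fun ξ => m ξ - D.filterSum a N ξ) k) := fun N => by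
    refine (congrArg (D.HasSymbol n Φ _) ?_).mpr (hf.sub (hsum N))
    funext η
    simp only [waveletSymbol, Pi.sub_apply]
    ring
  have hnorm : Tendsto (fun N => D.sobolevNorm s (f - ∑ i ∈ Finset.range N, a i • u (t i)))
      atTop (𝓝 0) := by
    have h1 := fun N => (hdiff N).sobolevNorm_eq hΦ hμ (D.measurable_waveletSymbol (hmN N) k)
      (D.memLp_waveletSymbol (hmN N) (hiN N) k)
    simp only [h1, eLpNorm_waveletSymbol, ENNReal.toReal_mul]
    have h2 := (ENNReal.tendsto_toReal ENNReal.zero_ne_top).comp hlim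
    simpa using h2.const_mul (‖(invSqrtCard p c)⁻¹‖ₑ).toReal
  obtain ⟨N, hN⟩ := (hnorm.eventually_lt_const hε).exists
  exact ⟨_, Submodule.sum_mem _ fun i _ => Submodule.smul_mem _ _
    (Submodule.subset_span ⟨t i, rfl⟩), hN⟩

/-- The entry `∑ r, m(ϖ ζ + ϖ λ(r)) conj m'(ϖ ζ + ϖ λ(r))` of the product of the filter matrix with
its adjoint. -/
noncomputable def correlation (D : LocalFieldData p c K) (m m' : K → ℂ) (ζ : K) : ℂ :=
  ∑ r : Fin (p ^ c), m ((D.ϖ : K) * ζ + (D.ϖ : K) * D.lam r) *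
    star (m' ((D.ϖ : K) * ζ + (D.ϖ : K) * D.lam r))

theorem integrableOn_mul_star {m m' : K → ℂ}
    (hi : MemLp m 2 ((haarK K).restrict (Metric.closedBall 0 1)))
    (hi' : MemLp m' 2 ((haarK K).restrict (Metric.closedBall 0 1))) :
    IntegrableOn (fun η => m η * star (m' η)) (Metric.closedBall 0 1) (haarK K) :=
  hi.integrable_mul hi'.star

theorem integrableOn_correlation (D : LocalFieldData p c K) {m m' : K → ℂ}
    (hi : MemLp m 2 ((haarK K).restrict (Metric.closedBall 0 1)))
    (hi' : MemLp m' 2 ((haarK K).restrict (Metric.closedBall 0 1))) :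
    IntegrableOn (D.correlation m m') (Metric.closedBall 0 1) (haarK K) :=
  integrable_finsetSum _ fun r _ => integrableOn_comp_ϖ_mul_add (integrableOn_mul_star hi hi') r.2

/-- The two factors `q^(1/2)` supply the `q` of the decomposition. At `ϖζ + ϖλ(r)` the character of
`λ(qk)` takes the value at `ζ` of that of `λ(k)`, because `χ(λ(r)λ(k)) = 1`; it is independent of
`r` and leaves the sum. -/
theorem integral_waveletSymbol_mul_star (D : LocalFieldData p c K) {m m' : K → ℂ}
    (hi : MemLp m 2 ((haarK K).restrict (Metric.closedBall 0 1)))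
    (hi' : MemLp m' 2 ((haarK K).restrict (Metric.closedBall 0 1))) (k k' : ℕ) :
    ∫ η in Metric.closedBall 0 1, D.waveletSymbol m k η * star (D.waveletSymbol m' k' η)
        ∂(haarK K) =
      ∫ ζ in Metric.closedBall 0 1, D.χBdd (-D.lam k) ζ * star (D.χBdd (-D.lam k') ζ) *
        D.correlation m m' ζ ∂(haarK K) := by
  have h1 : ∀ η, D.waveletSymbol m k η * star (D.waveletSymbol m' k' η) = ((p ^ c : ℕ) : ℂ) *
      (D.χBdd (-D.lam (p ^ c * k) + D.lam (p ^ c * k')) η * (m η * star (m' η))) := fun η => by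
    have e1 : star (D.χBdd (-D.lam (p ^ c * k')) η) = D.χBdd (D.lam (p ^ c * k')) η := by
      rw [← star_χBdd, BoundedContinuousFunction.star_apply, star_star]
    rw [← invSqrtCard_inv_mul_star, waveletSymbol, waveletSymbol, star_mul', star_mul', e1,
      ← χBdd_mul, BoundedContinuousFunction.mul_apply]
    ring
  have hint : IntegrableOn (fun η => D.χBdd (-D.lam (p ^ c * k) + D.lam (p ^ c * k')) η *
      (m η * star (m' η))) (Metric.closedBall 0 1) (haarK K) :=
    (integrableOn_mul_star hi hi').bdd_mul (c := 1) (D.χBdd _).continuous.aestronglyMeasurable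
      (Eventually.of_forall fun x => (D.norm_χBdd _ x).le)
  simp only [h1]
  rw [integral_const_mul, integral_ringOfIntegers_decompose (D := D) hint]
  congr 1
  funext ζ
  rw [correlation, Finset.mul_sum]
  refine Finset.sum_congr rfl fun r _ => ?_
  congr 1
  have e1 : star (D.χBdd (-D.lam k') ζ) = D.χBdd (D.lam k') ζ := by
    rw [← star_χBdd, BoundedContinuousFunction.star_apply, star_star]
  rw [e1, ← BoundedContinuousFunction.mul_apply, χBdd_mul, χBdd_apply, χBdd_apply]
  have e2 : ((D.ϖ : K) * ζ + (D.ϖ : K) * D.lam r) *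
      (-D.lam (p ^ c * k) + D.lam (p ^ c * k')) =
      ζ * (-D.lam k + D.lam k') + D.lam r * (-D.lam k + D.lam k') := by
    rw [← inv_ϖ_mul_lam, ← inv_ϖ_mul_lam]
    have := D.ϖ_ne_zero
    field_simp
  rw [e2, AddChar.map_add_eq_mul, D.χ_mul_eq_one_of_mem_lattice (D.lam_mem_lattice r)
    (D.lattice.add_mem (D.lattice.neg_mem (D.lam_mem_lattice k)) (D.lam_mem_lattice k')), mul_one]

/-- A function on the ring of integers with the Fourier coefficients of a constant is constant. -/
theorem ae_eq_const_of_integral_χBdd_mul (D : LocalFieldData p c K) {F : K → ℂ} {b : ℂ}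
    (hF : IntegrableOn F (Metric.closedBall 0 1) (haarK K))
    (h : ∀ k, ∫ ζ in Metric.closedBall 0 1, D.χBdd (-D.lam 0) ζ * star (D.χBdd (-D.lam k) ζ) *
      F ζ ∂(haarK K) = if k = 0 then b else 0) :
    ∀ᵐ ζ ∂((haarK K).restrict (Metric.closedBall 0 1)), F ζ = b := by
  have hms : MeasurableSet (Metric.closedBall (0 : K) 1) := Metric.isClosed_closedBall.measurableSet
  have hFb : IntegrableOn (fun ζ => F ζ - b) (Metric.closedBall 0 1) (haarK K) :=
    hF.sub (integrable_const b)
  have h1 := D.ae_eq_zero_of_integral_mul_χ_eq_zero ((integrable_indicator_iff hms).2 hFb) fun ξ => by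
    -- As for measures, every frequency acts on the ring of integers as a lattice frequency, so the
    -- given coefficients suffice.
    obtain ⟨k, hk⟩ := D.exists_lam_sub_le ξ
    have hχ : ∀ x ∈ Metric.closedBall (0 : K) 1, (F x - b) * (D.χ (x * ξ) : ℂ) =
        D.χBdd (-D.lam 0) x * star (D.χBdd (-D.lam k) x) * F x -
          b * (D.χBdd (-D.lam 0) x * star (D.χBdd (-D.lam k) x)) := fun x hx => by
      have e1 : x * ξ = x * D.lam k + x * (ξ - D.lam k) := by ring
      have e2 : star (D.χBdd (-D.lam k) x) = D.χBdd (D.lam k) x := by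
        rw [← star_χBdd, BoundedContinuousFunction.star_apply, star_star]
      have e3 : D.χBdd (-D.lam 0) x = 1 := by simp [χBdd_apply, lam_zero]
      rw [e1, D.χ_add_eq _ _ (by
        rw [norm_mul]
        exact mul_le_one₀ (mem_closedBall_zero_iff.1 hx) (norm_nonneg _) hk), e2, e3, χBdd_apply]
      ring
    have e4 : ∀ x, (Metric.closedBall (0 : K) 1).indicator (fun ζ => F ζ - b) x *
        (D.χ (x * ξ) : ℂ) = (Metric.closedBall (0 : K) 1).indicator
          (fun x => (F x - b) * (D.χ (x * ξ) : ℂ)) x := fun x =>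
      (Set.indicator_mul_left _ (fun ζ => F ζ - b) fun x => (D.χ (x * ξ) : ℂ)).symm
    have hi1 : IntegrableOn (fun x => D.χBdd (-D.lam 0) x * star (D.χBdd (-D.lam k) x))
        (Metric.closedBall 0 1) (haarK K) :=
      (D.χBdd (-D.lam 0) * star (D.χBdd (-D.lam k))).integrable _
    simp only [e4]
    rw [integral_indicator hms, setIntegral_congr_fun hms hχ, integral_sub, h k,
      integral_const_mul, integral_χBdd_mul_star]
    · split_ifs with hk0 hk1 hk1
      · ring
      · exact absurd hk0.symm hk1
      · exact absurd hk1.symm hk0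
      · ring
    · refine hF.bdd_mul (c := 1)
        (D.χBdd (-D.lam 0) * star (D.χBdd (-D.lam k))).continuous.aestronglyMeasurable
        (Eventually.of_forall fun x => ?_)
      rw [norm_mul, norm_star, norm_χBdd, norm_χBdd, one_mul]
    · exact hi1.const_mul b
  rw [ae_restrict_iff' hms]
  filter_upwards [h1] with x hx hmem
  rw [Set.indicator_of_mem hmem] at hx
  exact sub_eq_zero.1 hx

/-- For integral `ξ` and `r < q` the point `ϖξ + ϖλ(r)` is integral, so folding does nothing; the
affine map pulls null sets back to null sets. -/
theorem ae_filterMatrix_apply (D : LocalFieldData p c K) {a : Fin (p ^ c) → ℕ → ℂ}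
    {m : Fin (p ^ c) → K → ℂ} (h : ∀ l, D.filter (a l) =ᵐ[haarK K] m l ∘ D.fold) :
    ∀ᵐ ξ ∂((haarK K).restrict (Metric.closedBall 0 1)), ∀ l r, D.filterMatrix a ξ l r =
      m l ((D.ϖ : K) * ξ + (D.ϖ : K) * D.lam r) := by
  rw [ae_restrict_iff' Metric.isClosed_closedBall.measurableSet]
  have h1 : ∀ l, ∀ r : Fin (p ^ c), ∀ᵐ ξ ∂(haarK K),
      D.filter (a l) ((D.ϖ : K) * ξ + (D.ϖ : K) * D.lam r) =
        m l (D.fold ((D.ϖ : K) * ξ + (D.ϖ : K) * D.lam r)) := fun l r => by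
    have hq : Measure.QuasiMeasurePreserving
        (fun ξ : K => (D.ϖ : K) * ξ + (D.ϖ : K) * D.lam r) (haarK K) (haarK K) := by
      have h0 := D.quasiMeasurePreserving_zpow_ϖ_mul 1
      simp only [zpow_one] at h0
      exact (measurePreserving_add_right (haarK K)
        ((D.ϖ : K) * D.lam r)).quasiMeasurePreserving.comp h0
    have h3 := hq.ae (h l)
    exact h3
  filter_upwards [ae_all_iff.2 fun l => ae_all_iff.2 (h1 l)] with ξ hξ hmem l r
  rw [filterMatrix, Matrix.of_apply, hξ l r, D.fold_eq_self]
  rw [← mul_add, add_comm]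
  have h2 : D.lam r + ξ ∈ {x : K | ‖(D.ϖ : K) * x‖ ≤ 1} := by
    rw [D.setOf_norm_ϖ_mul_le]
    exact Set.mem_iUnion.2 ⟨r, ξ, hmem, rfl⟩
  exact h2

end Wavelets

end LocalFieldData

/-! ### Orthonormality against unitarity. -/

theorem mainTheorem2 {p c : ℕ} [Fact p.Prime] [NeZero c] {K : Type*} [NontriviallyNormedField K]
    [IsUltrametricDist K] [LocallyCompactSpace K] [CharP K p] [MeasurableSpace K] [BorelSpace K]
    (D : LocalFieldData p c K) (s : ℝ) (ν : ℤ)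
    (φ : ℤ → TemperedDistr K) (α : ℤ → Fin (p ^ c) → ℕ → ℂ) (j : ℤ)
    (hα : ∀ l, Memℓp (α (j + 1) l) 2)
    (hφ : D.OrthonormalSystem s fun k : ℕ => D.dilTrans (ν + 1) (φ (j + 1)) k) :
    (∀ l, D.HasFilter (α (j + 1) l) (D.filter (α (j + 1) l)) ∧
      D.HasFourier (D.wavelet (α (j + 1) l) (φ (j + 1)))
        (fun ξ => D.filter (α (j + 1) l) (D.ϖ * ξ) * D.hat (φ (j + 1)) (D.ϖ * ξ)) ∧
      ∀ k : ℕ, D.dilTrans ν (D.wavelet (α (j + 1) l) (φ (j + 1))) k ∈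
        D.closedSpan s fun n : ℕ => D.dilTrans (ν + 1) (φ (j + 1)) n) ∧
    (D.OrthonormalSystem s (fun x : Fin (p ^ c) × ℕ =>
        D.dilTrans ν (D.wavelet (α (j + 1) x.1) (φ (j + 1))) x.2) ↔
      ∀ᵐ ξ ∂((haarK K).restrict (Metric.closedBall 0 1)),
        D.filterMatrix (α (j + 1)) ξ ∈ Matrix.unitaryGroup (Fin (p ^ c)) ℂ) := by
  obtain ⟨g, hg, -⟩ := hφ.1 0
  obtain ⟨g', hg'⟩ := D.exists_hasFourier_of_dilTrans hg
  have hΦ := hg'.hasFourier_hat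
  set Φ := D.hat (φ (j + 1)) with hΦ_def
  have hΦm : AEStronglyMeasurable Φ (haarK K) := hΦ.1.aestronglyMeasurable
  have hμ := LocalFieldData.map_fold_spectralMeasure hΦ hφ
  choose m hm hi hlim using fun l => D.exists_tendsto_filterSum (hα l)
  have hfold := fun l => D.hasFilter_comp_fold (hm l) (hlim l)
  have hfilter := fun l => (hfold l).hasFilter_filter
  have hae := fun l => (hfilter l).ae_eq (hfold l)
  have hae' : ∀ l, (fun ξ => m l (D.fold ((D.ϖ : K) * ξ)) * Φ ((D.ϖ : K) * ξ)) =ᵐ[haarK K]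
      fun ξ => D.filter (α (j + 1) l) (D.ϖ * ξ) * Φ (D.ϖ * ξ) := fun l => by
    have h1 := (D.quasiMeasurePreserving_zpow_ϖ_mul 1).ae (hae l)
    filter_upwards [h1] with ξ hξ
    rw [zpow_one] at hξ
    rw [hξ]
    rfl
  have hψ : ∀ l, D.HasFourier (D.wavelet (α (j + 1) l) (φ (j + 1)))
      (fun ξ => D.filter (α (j + 1) l) (D.ϖ * ξ) * Φ (D.ϖ * ξ)) := fun l => by
    have h1 := D.locallyIntegrable_zpow_ϖ_mul 1
      (LocalFieldData.locallyIntegrable_symbol_mul hΦm hμ (hm l) (hi l))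
    simp only [zpow_one] at h1
    -- The auxiliary distribution serves only to carry local integrability across the almost
    -- everywhere equality.
    exact D.hasFourier_invHat ((D.exists_hasFourier h1).choose_spec.congr (hae' l)).1
  have hsym := fun l k => ((hψ l).congr (hae' l).symm).hasSymbol_dilTrans_wavelet ν k
  refine ⟨fun l => ⟨hfilter l, hψ l, fun k => ?_⟩, ?_⟩
  · exact LocalFieldData.hasSymbol_mem_closedSpan hΦm hμ (fun n => hΦ.hasSymbol_dilTrans (ν + 1) n)
      (hm l) (hi l) (hlim l) (hsym l k)
  have hinner : ∀ l k l' k', D.sobolevInner s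
      (D.dilTrans ν (D.wavelet (α (j + 1) l) (φ (j + 1))) k)
      (D.dilTrans ν (D.wavelet (α (j + 1) l') (φ (j + 1))) k') =
      ∫ ζ in Metric.closedBall 0 1, D.χBdd (-D.lam k) ζ * star (D.χBdd (-D.lam k') ζ) *
        D.correlation (m l) (m l') ζ ∂(haarK K) := fun l k l' k' => by
    rw [(hsym l k).sobolevInner_eq hΦm hμ (hsym l' k') (D.measurable_waveletSymbol (hm l) k)
      (D.measurable_waveletSymbol (hm l') k'), D.integral_waveletSymbol_mul_star (hi l) (hi l')]
  -- The correlations are the entries of `M M*`; for a square matrix `M M* = 1` is already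
  -- unitarity.
  have hunit : (∀ᵐ ξ ∂((haarK K).restrict (Metric.closedBall 0 1)),
      D.filterMatrix (α (j + 1)) ξ ∈ Matrix.unitaryGroup (Fin (p ^ c)) ℂ) ↔
      ∀ᵐ ξ ∂((haarK K).restrict (Metric.closedBall 0 1)),
        ∀ l l', D.correlation (m l) (m l') ξ = if l = l' then 1 else 0 := by
    refine eventually_congr ?_
    filter_upwards [D.ae_filterMatrix_apply hae] with ξ hξ
    rw [Matrix.mem_unitaryGroup_iff, ← Matrix.ext_iff]
    refine forall_congr' fun l => forall_congr' fun l' => ?_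
    rw [Matrix.mul_apply, Matrix.one_apply]
    simp only [Matrix.star_apply, hξ]
    rfl
  rw [hunit]
  constructor
  · intro h
    rw [ae_all_iff]
    intro l
    rw [ae_all_iff]
    intro l'
    refine D.ae_eq_const_of_integral_χBdd_mul (D.integrableOn_correlation (hi l) (hi l'))
      fun k => ?_
    -- Fixing the first translate at `0` already yields all Fourier coefficients of the correlation.
    rw [← hinner, h.2 (l, 0) (l', k)]
    by_cases hl : l = l' <;> by_cases hk : k = 0 <;> simp [hl, hk, eq_comm (a := 0)]
  · intro h
    refine ⟨fun x => (hsym x.1 x.2).memSobolev hΦm hμ (D.measurable_waveletSymbol (hm x.1) x.2)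
      (D.memLp_waveletSymbol (hm x.1) (hi x.1) x.2), ?_⟩
    rintro ⟨l, k⟩ ⟨l', k'⟩
    rw [hinner]
    have h1 : ∀ᵐ ζ ∂((haarK K).restrict (Metric.closedBall 0 1)),
        D.χBdd (-D.lam k) ζ * star (D.χBdd (-D.lam k') ζ) * D.correlation (m l) (m l') ζ =
          D.χBdd (-D.lam k) ζ * star (D.χBdd (-D.lam k') ζ) * if l = l' then 1 else 0 := by
      filter_upwards [h] with ζ hζ
      rw [hζ]
    rw [integral_congr_ae h1, integral_mul_const, D.integral_χBdd_mul_star]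
    by_cases hl : l = l' <;> by_cases hk : k = k' <;> simp [hl, hk]
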